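/- A unit square is a closed square of edge length $1$ in the Euclidean plane, in arbitrary position. For a positive integer $n$ let $S(n)$ be the largest edge length of a square that can be covered by $n$ unit squares, and let $S_{\mathrm{bd}}(n)$ be the largest edge length of a square whose boundary can be covered by $n$ unit squares. For every $n\ge 4$ the maximum defining $S_{\mathrm{bd}}(n)$ exists, as does the one defining $S(5)$, and the following hold. (i) $S_{\mathrm{bd}}(n+4)=S_{\mathrm{bd}}(n)+\sqrt2$ for every $n\ge 4$. (ii) $S_{\mathrm{bd}}(4)=2$. If four unit squares cover the boundary of a square $S$ of edge length $2$ (in particular, if they cover $S$), then each of them is a homothetic copy of $S$. (iii) $S_{\mathrm{bd}}(5)=\bar x+1\approx 2.072$ (rounded to three decimals), where $\bar x=\frac12\sqrt2\,\sqrt{\sqrt{13-8\sqrt2}+1}$. If five unit squares cover the boundary of a square $S$ of edge length $S_{\mathrm{bd}}(5)$, then $S$ together with the five squares is congruent to the following configuration (which therefore is a covering of this kind). The large square is $[0,\bar x+1]^2$. With $w=\sqrt{\bar x^2-1}$, the five unit squares are: the square $[0,1]^2$; the square with vertex $(1,0)$ and edge vectors $\frac1{\bar x}(w,1)$, $\frac1{\bar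 x}(1,-w)$ at this vertex, and its mirror image in the line $y=x$; the square having the segment from $(\bar x+1,\bar x+1-\sqrt2)$ to $(\bar x+1,\bar x+1)$ as a diagonal, and its mirror image in the line $y=x$. Moreover, $S(5)<S_{\mathrm{bd}}(5)$. -/

import Mathlib

open Set

noncomputable section

namespace SquareCover

/-- The Euclidean plane. -/
abbrev Plane : Type := EuclideanSpace ℝ (Fin 2)

/-- The set of all points `p + s u + t v` with `0 ≤ s, t ≤ a`. For orthonormal `u`, `v` and `a > 0`
this is the closed square with a vertex `p`, edge directions `u`, `v` and edge length `a`. -/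
def squareAt (p u v : Plane) (a : ℝ) : Set Plane :=
  {x | ∃ s ∈ Icc (0 : ℝ) a, ∃ t ∈ Icc (0 : ℝ) a, x = p + s • u + t • v}

/-- `Q` is a closed square of edge length `a`, in arbitrary position. -/
def IsSquareOfEdge (a : ℝ) (Q : Set Plane) : Prop :=
  0 < a ∧ ∃ p u v : Plane, ‖u‖ = 1 ∧ ‖v‖ = 1 ∧ inner ℝ u v = 0 ∧ Q = squareAt p u v a

/-- The set `A` is covered by the family `F` of unit squares. -/
def IsUnitSquareCover {n : ℕ} (F : Fin n → Set Plane) (A : Set Plane) : Prop :=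
  (∀ i, IsSquareOfEdge 1 (F i)) ∧ A ⊆ ⋃ i, F i

/-- The edge lengths of the squares that can be covered by `n` unit squares. -/
def coverableEdges (n : ℕ) : Set ℝ :=
  {a | ∃ Q : Set Plane, IsSquareOfEdge a Q ∧ ∃ F : Fin n → Set Plane, IsUnitSquareCover F Q}

/-- The edge lengths of the squares whose boundary can be covered by `n` unit squares. -/
def bdCoverableEdges (n : ℕ) : Set ℝ :=
  {a | ∃ Q : Set Plane, IsSquareOfEdge a Q ∧
    ∃ F : Fin n → Set Plane, IsUnitSquareCover F (frontier Q)}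

/-- The largest edge length of a square that can be covered by `n` unit squares. -/
def S (n : ℕ) : ℝ := sSup (coverableEdges n)

/-- The largest edge length of a square whose boundary can be covered by `n` unit squares. -/
def Sbd (n : ℕ) : ℝ := sSup (bdCoverableEdges n)

/-- `A` is a (positive) homothetic copy of `B`. -/
def IsHomotheticTo (A B : Set Plane) : Prop :=
  ∃ (c : Plane) (k : ℝ), 0 < k ∧ A = AffineMap.homothety c k '' B

/-- The number `x̄ ≈ 1.072`. -/
def xbar : ℝ := 1 / 2 * √2 * √(√(13 - 8 * √2) + 1)

/-- The number `√(x̄² - 1)`. -/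
def wbar : ℝ := √(xbar ^ 2 - 1)

/-- The big square `[0, x̄ + 1]²` of the optimal five-square configuration. -/
def optSquare : Set Plane := squareAt !₂[0, 0] !₂[1, 0] !₂[0, 1] (xbar + 1)

/-- The five unit squares of the optimal configuration:
the square `[0, 1]²` at the vertex `(0, 0)` of the big square;
the two unit squares, mirror images of each other in the line `y = x`, that have a vertex at
`(1, 0)`, respectively `(0, 1)`, and contain the vertex `(x̄ + 1, 0)`, respectively `(0, x̄ + 1)`,
of the big square on one of their sides;
the two unit squares having as a diagonal the segment of length `√2` that starts at
`(x̄ + 1, x̄ + 1)` and runs along the right, respectively the upper, side of the big square. -/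
def optUnitSquare : Fin 5 → Set Plane :=
  ![squareAt !₂[0, 0] !₂[1, 0] !₂[0, 1] 1,
    squareAt !₂[1, 0] !₂[wbar / xbar, 1 / xbar] !₂[1 / xbar, -(wbar / xbar)] 1,
    squareAt !₂[0, 1] !₂[1 / xbar, wbar / xbar] !₂[-(wbar / xbar), 1 / xbar] 1,
    squareAt !₂[xbar + 1, xbar + 1 - √2] !₂[√2 / 2, √2 / 2] !₂[-(√2 / 2), √2 / 2] 1,
    squareAt !₂[xbar + 1 - √2, xbar + 1] !₂[√2 / 2, √2 / 2] !₂[√2 / 2, -(√2 / 2)] 1]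

/-- The square `Q` together with the (unordered) family `F` is congruent to the optimal
configuration. -/
def IsOptimalConfiguration (Q : Set Plane) (F : Fin 5 → Set Plane) : Prop :=
  ∃ (φ : Plane ≃ᵢ Plane) (σ : Equiv.Perm (Fin 5)),
    Q = φ '' optSquare ∧ ∀ i, F i = φ '' optUnitSquare (σ i)

end SquareCover

end

noncomputable section

namespace SquareCover

/-! Up to an isometry the large square is `[0, a]²`, and a unit square is the intersection of two
perpendicular strips of width 1 (`IsUnitSq`). Two facts about a unit square carry everything. Its
diameter is `√2`, so it cannot meet opposite sides once `a > √2`. If it contains the vertex of a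
right angle and one leg of length `x ≥ 1`, the other leg is at most `leg x`, and equality fixes its
position (`leg_aux`, `IsUnitSq.eq_of_leg_eq`). The maxima exist by compactness
(`exists_isGreatest_scale`).

The recursion comes from cutting each side once. The squares meeting a side fall into two groups,
one for each end, and moving the groups is consistent for all four sides at once
(`exists_translates`). Pulled apart by `√2`, they leave a gap on each side that one further square
fills with its diagonal (`exists_bottomSplit_expand`). Conversely, one square covering the midpoint
is removed from each side and the rest is pushed together by any `δ > √2`
(`exists_bottomSplit_shrink`); then `δ` tends to `√2`.

With four squares, each owns a vertex, and neighbours meet on the common side. The two legs cut off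
at a vertex satisfy `u² + v² ≤ 2`, hence `u + v ≤ 2`; the four sums add up to the perimeter, so `4a
≤ 8`, and for `a = 2` every leg is 1.

With five squares, four own the vertices, and symmetry reduces to the case where the fifth
contributes to the right side only. The bounds for the legs then form a chain around the boundary.
Linear estimates of `leg` turn this chain into a linear problem whose only solution has `a = x̄ + 1`
(`legs_eq`), where `x̄` is determined by `leg x̄ + √2 = x̄ + 1`. Equality in the leg bounds fixes
all five squares. These miss an interior point, whence `S 5 < Sbd 5`. -/

/-! ### Squares and isometries in coordinates. -/

/-- The point with coordinates `x`, `y`. -/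
def pt (x y : ℝ) : Plane := !₂[x, y]

@[simp] lemma pt_zero (x y : ℝ) : pt x y 0 = x := by simp [pt]
@[simp] lemma pt_one (x y : ℝ) : pt x y 1 = y := by simp [pt]

lemma plane_ext {z z' : Plane} (h0 : z 0 = z' 0) (h1 : z 1 = z' 1) : z = z' := by
  ext i; fin_cases i <;> assumption

@[simp] lemma pt_eta (z : Plane) : pt (z 0) (z 1) = z := plane_ext (by simp) (by simp)

lemma inner_plane (z z' : Plane) : inner ℝ z z' = z 0 * z' 0 + z 1 * z' 1 := by
  simp [PiLp.inner_apply, Fin.sum_univ_two, mul_comm]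

lemma norm_plane_eq_one {z : Plane} : ‖z‖ = 1 ↔ z 0 ^ 2 + z 1 ^ 2 = 1 := by
  rw [EuclideanSpace.norm_eq, Real.sqrt_eq_one]
  simp [Fin.sum_univ_two]

lemma exists_frameIso (p : Plane) {u v : Plane} (hu : ‖u‖ = 1) (hv : ‖v‖ = 1)
    (huv : inner ℝ u v = 0) : ∃ φ : Plane ≃ᵢ Plane, ∀ z, φ z = p + z 0 • u + z 1 • v := by
  have ho : Orthonormal ℝ ![u, v] := by
    constructor
    · intro i; fin_cases i <;> simpa
    · intro i j hij
      fin_cases i <;> fin_cases j <;> simp_all [real_inner_comm]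
  have hs : ⊤ ≤ Submodule.span ℝ (Set.range ![u, v]) := by
    refine ((Submodule.eq_top_of_finrank_eq ?_).symm).le
    rw [finrank_span_eq_card ho.linearIndependent]
    simp
  refine ⟨(OrthonormalBasis.mk ho hs).repr.symm.toIsometryEquiv.trans (IsometryEquiv.addLeft p),
    fun z => ?_⟩
  rw [IsometryEquiv.trans_apply, LinearIsometryEquiv.coe_toIsometryEquiv,
    ← OrthonormalBasis.sum_repr_symm, OrthonormalBasis.coe_mk, Fin.sum_univ_two]
  simp [add_assoc]

/-- The isometry of the plane that maps `(x, y)` to `p + x u + y v`. -/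
def frameIso (p u v : Plane) (hu : ‖u‖ = 1) (hv : ‖v‖ = 1) (huv : inner ℝ u v = 0) :
    Plane ≃ᵢ Plane :=
  (exists_frameIso p hu hv huv).choose

lemma frameIso_apply {p u v : Plane} (hu : ‖u‖ = 1) (hv : ‖v‖ = 1) (huv : inner ℝ u v = 0)
    (z : Plane) : frameIso p u v hu hv huv z = p + z 0 • u + z 1 • v :=
  (exists_frameIso p hu hv huv).choose_spec z

/-- The square `[0, a]²`. -/
def box (a : ℝ) : Set Plane := squareAt !₂[0, 0] !₂[1, 0] !₂[0, 1] a

lemma mem_box {a : ℝ} {z : Plane} :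
    z ∈ box a ↔ (0 ≤ z 0 ∧ z 0 ≤ a) ∧ (0 ≤ z 1 ∧ z 1 ≤ a) := by
  constructor
  · rintro ⟨s, hs, t, ht, rfl⟩
    simpa using ⟨hs, ht⟩
  · rintro ⟨h0, h1⟩
    exact ⟨z 0, h0, z 1, h1, plane_ext (by simp) (by simp)⟩

lemma isSquareOfEdge_box {a : ℝ} (ha : 0 < a) : IsSquareOfEdge a (box a) :=
  ⟨ha, _, _, _, by simp [norm_plane_eq_one], by simp [norm_plane_eq_one],
    by simp [inner_plane], rfl⟩

lemma squareAt_eq_image {p u v : Plane} (hu : ‖u‖ = 1) (hv : ‖v‖ = 1) (huv : inner ℝ u v = 0)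
    (a : ℝ) : squareAt p u v a = frameIso p u v hu hv huv '' box a := by
  ext z
  constructor
  · rintro ⟨s, hs, t, ht, rfl⟩
    exact ⟨pt s t, mem_box.2 (by simpa using ⟨hs, ht⟩), by simp [frameIso_apply]⟩
  · rintro ⟨y, hy, rfl⟩
    rw [mem_box] at hy
    exact ⟨y 0, hy.1, y 1, hy.2, frameIso_apply hu hv huv y⟩

lemma IsSquareOfEdge.exists_image_box {a : ℝ} {Q : Set Plane} (h : IsSquareOfEdge a Q) :
    ∃ φ : Plane ≃ᵢ Plane, Q = φ '' box a := by
  obtain ⟨-, p, u, v, hu, hv, huv, rfl⟩ := h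
  exact ⟨_, squareAt_eq_image hu hv huv a⟩

/-- A surjective isometry of the plane is affine (Mazur–Ulam), and its linear part preserves norms
and inner products. -/
lemma image_squareAt (φ : Plane ≃ᵢ Plane) (p u v : Plane) (a : ℝ) :
    ∃ p' u' v' : Plane, ‖u'‖ = ‖u‖ ∧ ‖v'‖ = ‖v‖ ∧ inner ℝ u' v' = inner ℝ u v ∧
      φ '' squareAt p u v a = squareAt p' u' v' a := by
  set L := φ.toRealAffineIsometryEquiv with hL
  have hφ : ∀ z, φ z = L z := fun z => rfl
  refine ⟨φ p, L.linearIsometryEquiv u, L.linearIsometryEquiv v, by simp, by simp,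
    L.linearIsometryEquiv.inner_map_map u v, ?_⟩
  have key : ∀ s t : ℝ, φ (p + s • u + t • v) =
      φ p + s • L.linearIsometryEquiv u + t • L.linearIsometryEquiv v := by
    intro s t
    have h1 := L.map_vadd p (s • u + t • v)
    rw [vadd_eq_add, vadd_eq_add, LinearIsometryEquiv.map_add, LinearIsometryEquiv.map_smul,
      LinearIsometryEquiv.map_smul] at h1
    rw [hφ, hφ, add_assoc, add_comm p, h1]
    abel
  ext z
  constructor
  · rintro ⟨_, ⟨s, hs, t, ht, rfl⟩, rfl⟩
    exact ⟨s, hs, t, ht, key s t⟩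
  · rintro ⟨s, hs, t, ht, rfl⟩
    exact ⟨_, ⟨s, hs, t, ht, rfl⟩, key s t⟩

lemma IsSquareOfEdge.image {a : ℝ} {Q : Set Plane} (h : IsSquareOfEdge a Q) (φ : Plane ≃ᵢ Plane) :
    IsSquareOfEdge a (φ '' Q) := by
  obtain ⟨ha, p, u, v, hu, hv, huv, rfl⟩ := h
  obtain ⟨p', u', v', hu', hv', huv', e⟩ := image_squareAt φ p u v a
  exact ⟨ha, p', u', v', hu'.trans hu, hv'.trans hv, huv'.trans huv, e⟩

/-- `(x, y)` lies on the boundary of `[0, a]²`. -/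
def OnBd (a x y : ℝ) : Prop :=
  ((0 ≤ x ∧ x ≤ a) ∧ (y = 0 ∨ y = a)) ∨ ((0 ≤ y ∧ y ≤ a) ∧ (x = 0 ∨ x = a))

lemma mem_frontier_box {a : ℝ} (ha : 0 < a) {z : Plane} :
    z ∈ frontier (box a) ↔ OnBd a (z 0) (z 1) := by
  have e : box a = (EuclideanSpace.equiv (Fin 2) ℝ).toHomeomorph ⁻¹'
      (Set.univ.pi fun _ => Icc 0 a) := by
    ext z
    simp [mem_box, Fin.forall_fin_two, Pi.le_def]
    tauto
  rw [e, ← Homeomorph.preimage_frontier, mem_preimage, frontier, closure_pi_set,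
    interior_pi_set Set.finite_univ]
  simp only [closure_Icc, interior_Icc, mem_sdiff, mem_univ_pi, Fin.forall_fin_two, mem_Icc, mem_Ioo]
  simp only [ContinuousLinearEquiv.coe_toHomeomorph, PiLp.coe_continuousLinearEquiv, OnBd]
  constructor
  · rintro ⟨⟨⟨h1, h2⟩, h3, h4⟩, h⟩
    by_contra hc
    push Not at hc
    obtain ⟨hc1, hc2⟩ := hc
    obtain ⟨c1, c2⟩ := hc1 ⟨h1, h2⟩
    obtain ⟨c3, c4⟩ := hc2 ⟨h3, h4⟩
    exact h ⟨⟨lt_of_le_of_ne h1 (Ne.symm c3), lt_of_le_of_ne h2 c4⟩,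
      lt_of_le_of_ne h3 (Ne.symm c1), lt_of_le_of_ne h4 c2⟩
  · rintro (⟨⟨h1, h2⟩, h | h⟩ | ⟨⟨h1, h2⟩, h | h⟩)
    all_goals
      refine ⟨⟨⟨?_, ?_⟩, ?_, ?_⟩, ?_⟩
      any_goals linarith
      rintro ⟨⟨_, _⟩, _, _⟩
      linarith

/-! ### Unit squares as intersections of two strips. -/

/-- The set of all points whose coordinates satisfy `m` is a unit square. -/
def IsUnitSq (m : ℝ → ℝ → Prop) : Prop :=
  ∃ c s p k : ℝ, c ^ 2 + s ^ 2 = 1 ∧ ∀ x y, m x y ↔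
    (p ≤ c * x + s * y ∧ c * x + s * y ≤ p + 1) ∧ (k ≤ c * y - s * x ∧ c * y - s * x ≤ k + 1)

lemma IsSquareOfEdge.isUnitSq {T : Set Plane} (h : IsSquareOfEdge 1 T) :
    IsUnitSq fun x y => pt x y ∈ T := by
  obtain ⟨-, p, u, v, hu, hv, huv, rfl⟩ := h
  rw [norm_plane_eq_one] at hu hv
  rw [inner_plane] at huv
  have hdet : (u 0 * v 1 - u 1 * v 0) ^ 2 = 1 := by
    linear_combination hv * (u 0 ^ 2 + u 1 ^ 2) + hu - (u 0 * v 0 + u 1 * v 1) * huv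
  -- The sign `ε` is the orientation of the frame: `v` is `ε` times `u` turned by a right angle.
  have main : ∀ ε : ℝ, v 0 = - (ε * u 1) → v 1 = ε * u 0 → ε ^ 2 = 1 → ∀ x y,
      (pt x y ∈ squareAt p u v 1 ↔ (0 ≤ u 0 * (x - p 0) + u 1 * (y - p 1) ∧
        u 0 * (x - p 0) + u 1 * (y - p 1) ≤ 1) ∧
        (0 ≤ ε * (u 0 * (y - p 1) - u 1 * (x - p 0)) ∧
          ε * (u 0 * (y - p 1) - u 1 * (x - p 0)) ≤ 1)) := by
    intro ε h0 h1 hε x y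
    constructor
    · rintro ⟨s, hs, t, ht, e⟩
      have e0 := congrArg (fun z : Plane => z 0) e
      have e1 := congrArg (fun z : Plane => z 1) e
      simp [h0, h1] at e0 e1
      have a1 : u 0 * (x - p 0) + u 1 * (y - p 1) = s := by
        rw [e0, e1]; linear_combination s * hu
      have a2 : ε * (u 0 * (y - p 1) - u 1 * (x - p 0)) = t := by
        rw [e0, e1]; linear_combination t * ε ^ 2 * hu + t * hε
      rw [a1, a2]
      exact ⟨hs, ht⟩
    · rintro ⟨hs, ht⟩
      refine ⟨_, hs, _, ht, plane_ext ?_ ?_⟩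
      · simp [h0]
        linear_combination (p 0 - x) * hu + (u 0 * (y - p 1) - u 1 * (x - p 0)) * u 1 * hε
      · simp [h1]
        linear_combination (p 1 - y) * hu - (u 0 * (y - p 1) - u 1 * (x - p 0)) * u 0 * hε
  have h1 : u 0 * v 1 - u 1 * v 0 = 1 ∨ u 0 * v 1 - u 1 * v 0 = -1 := by
    simpa using hdet
  rcases h1 with h1 | h1
  · have key := main 1 (by linear_combination (-v 0) * hu + u 0 * huv - u 1 * h1)
      (by linear_combination (-v 1) * hu + u 1 * huv + u 0 * h1) (by norm_num)
    refine ⟨u 0, u 1, u 0 * p 0 + u 1 * p 1, u 0 * p 1 - u 1 * p 0, hu, fun x y => ?_⟩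
    refine (key x y).trans ?_
    constructor <;> rintro ⟨⟨_, _⟩, _, _⟩ <;> refine ⟨⟨?_, ?_⟩, ?_, ?_⟩ <;> linarith
  · have key := main (-1) (by linear_combination (-v 0) * hu + u 0 * huv - u 1 * h1)
      (by linear_combination (-v 1) * hu + u 1 * huv + u 0 * h1) (by norm_num)
    -- For the negative orientation the second coordinate runs downwards from the vertex, so the
    -- strip begins one unit lower.
    refine ⟨u 0, u 1, u 0 * p 0 + u 1 * p 1, u 0 * p 1 - u 1 * p 0 - 1, hu, fun x y => ?_⟩
    refine (key x y).trans ?_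
    constructor <;> rintro ⟨⟨_, _⟩, _, _⟩ <;> refine ⟨⟨?_, ?_⟩, ?_, ?_⟩ <;> linarith

lemma IsUnitSq.isSquareOfEdge {m : ℝ → ℝ → Prop} (h : IsUnitSq m) :
    IsSquareOfEdge 1 {z : Plane | m (z 0) (z 1)} := by
  obtain ⟨c, s, p, k, hcs, hm⟩ := h
  refine ⟨one_pos, !₂[c * p - s * k, s * p + c * k], !₂[c, s], !₂[-s, c], ?_, ?_, ?_, ?_⟩
  · simp [norm_plane_eq_one, hcs]
  · simp [norm_plane_eq_one]; linarith
  · simp [inner_plane]; ring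
  · ext z
    simp only [mem_ofPred_eq, hm]
    constructor
    · rintro ⟨⟨h1, h2⟩, h3, h4⟩
      refine ⟨c * z 0 + s * z 1 - p, ⟨by linarith, by linarith⟩, c * z 1 - s * z 0 - k,
        ⟨by linarith, by linarith⟩, plane_ext ?_ ?_⟩
      · simp; linear_combination (-z 0) * hcs
      · simp; linear_combination (-z 1) * hcs
    · rintro ⟨σ, ⟨h1, h2⟩, τ, ⟨h3, h4⟩, rfl⟩
      simp
      have e1 : c * (c * p - s * k + σ * c + -(τ * s)) + s * (s * p + c * k + σ * s + τ * c) =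
        p + σ := by linear_combination (p + σ) * hcs
      have e2 : c * (s * p + c * k + σ * s + τ * c) - s * (c * p - s * k + σ * c + -(τ * s)) =
        k + τ := by linear_combination (k + τ) * hcs
      rw [e1, e2]
      refine ⟨⟨?_, ?_⟩, ?_, ?_⟩ <;> linarith

lemma isUnitSq_of_iso {T : Set Plane} (h : IsSquareOfEdge 1 T) (φ : Plane ≃ᵢ Plane) :
    IsUnitSq fun x y => φ (pt x y) ∈ T := by
  have := (h.image φ.symm).isUnitSq
  have e : ∀ z, z ∈ φ.symm '' T ↔ φ z ∈ T := by
    intro z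
    constructor
    · rintro ⟨w, hw, rfl⟩; simpa
    · intro hz; exact ⟨φ z, hz, by simp⟩
  simpa only [e] using this

/-- The regions `m i` cover the boundary of `[0, a]²`. -/
def CoversBd {ι : Type*} (m : ι → ℝ → ℝ → Prop) (a : ℝ) : Prop :=
  ∀ x y, OnBd a x y → ∃ i, m i x y

lemma coversBd_of_cover {n : ℕ} {F : Fin n → Set Plane} {Q : Set Plane} {a : ℝ} (ha : 0 < a)
    {φ : Plane ≃ᵢ Plane} (hQ : Q = φ '' box a) (h : IsUnitSquareCover F (frontier Q)) :
    (∀ i, IsUnitSq fun x y => φ (pt x y) ∈ F i) ∧ CoversBd (fun i x y => φ (pt x y) ∈ F i) a := by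
  refine ⟨fun i => isUnitSq_of_iso (h.1 i) φ, fun x y hxy => ?_⟩
  have : φ (pt x y) ∈ frontier Q := by
    have e := φ.toHomeomorph.image_frontier (box a)
    rw [hQ]
    change _ ∈ frontier (φ.toHomeomorph '' box a)
    rw [← e]
    exact ⟨pt x y, (mem_frontier_box ha).2 (by simpa using hxy), rfl⟩
  simpa using h.2 this

lemma cover_of_coversBd {n : ℕ} {m : Fin n → ℝ → ℝ → Prop} {a : ℝ} (ha : 0 < a)
    (hm : ∀ i, IsUnitSq (m i)) (h : CoversBd m a) :
    IsUnitSquareCover (fun i => {z : Plane | m i (z 0) (z 1)}) (frontier (box a)) := by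
  refine ⟨fun i => (hm i).isSquareOfEdge, fun z hz => ?_⟩
  simpa using h _ _ ((mem_frontier_box ha).1 hz)

lemma mem_bdCoverableEdges {n : ℕ} {a : ℝ} :
    a ∈ bdCoverableEdges n ↔
      0 < a ∧ ∃ m : Fin n → ℝ → ℝ → Prop, (∀ i, IsUnitSq (m i)) ∧ CoversBd m a := by
  constructor
  · rintro ⟨Q, hQ, F, hF⟩
    obtain ⟨φ, e⟩ := hQ.exists_image_box
    exact ⟨hQ.1, _, coversBd_of_cover hQ.1 e hF⟩
  · rintro ⟨ha, m, hm, h⟩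
    exact ⟨_, isSquareOfEdge_box ha, _, cover_of_coversBd ha hm h⟩

lemma mem_coverableEdges {n : ℕ} {a : ℝ} :
    a ∈ coverableEdges n ↔
      0 < a ∧ ∃ m : Fin n → ℝ → ℝ → Prop, (∀ i, IsUnitSq (m i)) ∧
        ∀ x y, ((0 ≤ x ∧ x ≤ a) ∧ (0 ≤ y ∧ y ≤ a)) → ∃ i, m i x y := by
  constructor
  · rintro ⟨Q, hQ, F, hF⟩
    obtain ⟨φ, e⟩ := hQ.exists_image_box
    refine ⟨hQ.1, _, fun i => isUnitSq_of_iso (hF.1 i) φ, fun x y hxy => ?_⟩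
    have : φ (pt x y) ∈ Q := e ▸ ⟨_, mem_box.2 (by simpa using hxy), rfl⟩
    simpa using hF.2 this
  · rintro ⟨ha, m, hm, h⟩
    refine ⟨_, isSquareOfEdge_box ha, fun i => {z : Plane | m i (z 0) (z 1)},
      fun i => (hm i).isSquareOfEdge, fun z hz => ?_⟩
    simpa using h _ _ (mem_box.1 hz)

namespace IsUnitSq

variable {m : ℝ → ℝ → Prop}

lemma swap (h : IsUnitSq m) : IsUnitSq fun x y => m y x := by
  obtain ⟨c, s, p, k, hcs, hm⟩ := h
  refine ⟨s, c, p, -k - 1, by linarith, fun x y => (hm y x).trans ?_⟩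
  constructor <;> rintro ⟨⟨_, _⟩, _, _⟩ <;> refine ⟨⟨?_, ?_⟩, ?_, ?_⟩ <;> linarith

lemma flip (h : IsUnitSq m) (a : ℝ) : IsUnitSq fun x y => m (a - x) y := by
  obtain ⟨c, s, p, k, hcs, hm⟩ := h
  refine ⟨c, -s, c * a - p - 1, k + s * a, by linarith, fun x y => (hm (a - x) y).trans ?_⟩
  constructor <;> rintro ⟨⟨_, _⟩, _, _⟩ <;> refine ⟨⟨?_, ?_⟩, ?_, ?_⟩ <;> linarith

lemma flip' (h : IsUnitSq m) (a : ℝ) : IsUnitSq fun x y => m x (a - y) :=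
  (h.swap.flip a).swap

lemma shift (h : IsUnitSq m) (a b : ℝ) : IsUnitSq fun x y => m (x - a) (y - b) := by
  obtain ⟨c, s, p, k, hcs, hm⟩ := h
  refine ⟨c, s, p + c * a + s * b, k + c * b - s * a, hcs, fun x y => (hm (x - a) (y - b)).trans ?_⟩
  constructor <;> rintro ⟨⟨_, _⟩, _, _⟩ <;> refine ⟨⟨?_, ?_⟩, ?_, ?_⟩ <;> linarith

/-- The direction of a unit square may be taken in the first quadrant. -/
lemma normal_form (h : IsUnitSq m) : ∃ c s p k : ℝ, 0 < c ∧ 0 ≤ s ∧ c ^ 2 + s ^ 2 = 1 ∧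
    ∀ x y, m x y ↔ (p ≤ c * x + s * y ∧ c * x + s * y ≤ p + 1) ∧
      (k ≤ c * y - s * x ∧ c * y - s * x ≤ k + 1) := by
  obtain ⟨c, s, p, k, hcs, hm⟩ := h
  have hne : c ≠ 0 ∨ s ≠ 0 := by
    by_contra hc
    push Not at hc
    simp [hc.1, hc.2] at hcs
  rcases lt_or_ge 0 c with hc | hc
  · rcases le_or_gt 0 s with hs | hs
    · exact ⟨c, s, p, k, hc, hs, hcs, hm⟩
    · refine ⟨-s, c, k, -p - 1, by linarith, by linarith, by linarith,
        fun x y => (hm x y).trans ?_⟩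
      constructor <;> rintro ⟨⟨_, _⟩, _, _⟩ <;> refine ⟨⟨?_, ?_⟩, ?_, ?_⟩ <;> linarith
  · rcases lt_or_ge 0 s with hs | hs
    · refine ⟨s, -c, -k - 1, p, by linarith, by linarith, by linarith,
        fun x y => (hm x y).trans ?_⟩
      constructor <;> rintro ⟨⟨_, _⟩, _, _⟩ <;> refine ⟨⟨?_, ?_⟩, ?_, ?_⟩ <;> linarith
    · rcases hc.lt_or_eq with hc' | hc'
      · refine ⟨-c, -s, -p - 1, -k - 1, by linarith, by linarith, by linarith,
          fun x y => (hm x y).trans ?_⟩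
        constructor <;> rintro ⟨⟨_, _⟩, _, _⟩ <;> refine ⟨⟨?_, ?_⟩, ?_, ?_⟩ <;> linarith
      · have : s < 0 := hs.lt_of_ne (by tauto)
        refine ⟨-s, c, k, -p - 1, by linarith, by linarith, by linarith,
          fun x y => (hm x y).trans ?_⟩
        constructor <;> rintro ⟨⟨_, _⟩, _, _⟩ <;> refine ⟨⟨?_, ?_⟩, ?_, ?_⟩ <;> linarith

/-- The distance can be measured in the square's own axes, where both coordinate differences are at
most 1. -/
lemma sq_add_sq_le (h : IsUnitSq m) {x y x' y' : ℝ} (h1 : m x y) (h2 : m x' y') :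
    (x - x') ^ 2 + (y - y') ^ 2 ≤ 2 := by
  obtain ⟨c, s, p, k, hcs, hm⟩ := h
  rw [hm] at h1 h2
  have e : (x - x') ^ 2 + (y - y') ^ 2 = ((c * x + s * y) - (c * x' + s * y')) ^ 2 +
      ((c * y - s * x) - (c * y' - s * x')) ^ 2 := by
    linear_combination (-(x - x') ^ 2 - (y - y') ^ 2) * hcs
  have h3 : ((c * x + s * y) - (c * x' + s * y')) ^ 2 ≤ 1 :=
    (sq_le_one_iff_abs_le_one _).2 (abs_le.2 ⟨by linarith [h1.1.1, h2.1.2], by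
      linarith [h2.1.1, h1.1.2]⟩)
  have h4 : ((c * y - s * x) - (c * y' - s * x')) ^ 2 ≤ 1 :=
    (sq_le_one_iff_abs_le_one _).2 (abs_le.2 ⟨by linarith [h1.2.1, h2.2.2], by
      linarith [h2.2.1, h1.2.2]⟩)
  linarith

lemma sub_le_sqrt_two (h : IsUnitSq m) {x y x' y' : ℝ} (h1 : m x y) (h2 : m x' y') :
    x' - x ≤ √2 :=
  Real.le_sqrt_of_sq_le (by nlinarith [h.sq_add_sq_le h1 h2, sq_nonneg (y - y')])

lemma sub_le_sqrt_two' (h : IsUnitSq m) {x y x' y' : ℝ} (h1 : m x y) (h2 : m x' y') :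
    y' - y ≤ √2 :=
  h.swap.sub_le_sqrt_two h1 h2

lemma convex (h : IsUnitSq m) {x x' t y : ℝ} (h1 : m x y) (h2 : m x' y) (hx : x ≤ t)
    (hx' : t ≤ x') : m t y := by
  obtain ⟨c, s, p, k, hc, hs, hcs, hm⟩ := h.normal_form
  rw [hm] at h1 h2 ⊢
  have := mul_le_mul_of_nonneg_left hx hc.le
  have := mul_le_mul_of_nonneg_left hx' hc.le
  have := mul_le_mul_of_nonneg_left hx hs
  have := mul_le_mul_of_nonneg_left hx' hs
  refine ⟨⟨?_, ?_⟩, ?_, ?_⟩ <;> linarith [h1.1.1, h1.1.2, h1.2.1, h1.2.2, h2.1.1, h2.1.2, h2.2.1,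
    h2.2.2]

lemma isClosed (h : IsUnitSq m) (y : ℝ) : IsClosed {x | m x y} := by
  obtain ⟨c, s, p, k, hcs, hm⟩ := h
  have e : {x | m x y} = ({x | p ≤ c * x + s * y} ∩ {x | c * x + s * y ≤ p + 1}) ∩
      ({x | k ≤ c * y - s * x} ∩ {x | c * y - s * x ≤ k + 1}) := by
    ext x
    exact hm x y
  rw [e]
  refine IsClosed.inter (IsClosed.inter ?_ ?_) (IsClosed.inter ?_ ?_)
  all_goals exact isClosed_le (by fun_prop) (by fun_prop)

/-- A unit square that meets the `y`-axis in the upper half plane and the `x`-axis right of `1`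
contains `(1/2, 0)`. -/
lemma half_mem (h : IsUnitSq m) {t z : ℝ} (ht : 0 ≤ t) (hz : 1 < z) (h1 : m 0 t) (h2 : m z 0) :
    m (1 / 2) 0 := by
  obtain ⟨c, s, p, k, hc, hs, hcs, hm⟩ := h.normal_form
  rw [hm] at h1 h2 ⊢
  have h3 : c * (1 / 2) ≤ c * z := mul_le_mul_of_nonneg_left (by linarith) hc.le
  have h4 : s * (1 / 2) ≤ s * z := mul_le_mul_of_nonneg_left (by linarith) hs
  have h5 : 0 ≤ c * t := mul_nonneg hc.le ht
  refine ⟨⟨?_, ?_⟩, ?_, ?_⟩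
  · by_contra hlt
    have h6 : c / 2 < s * t := by linarith [h1.1.1]
    have hs0 : 0 < s := by
      by_contra hs0
      have : s = 0 := le_antisymm (not_lt.1 hs0) hs
      rw [this] at h6
      linarith
    -- Since `z > 1`, this gives `s (c t + s) ≤ s`. Inserting `c / 2 < s t` yields `c² / 2 + s² <
    -- s`, that is, `(s - 1)² < 0`.
    have h7 : c * t + s * z ≤ 1 := by linarith [h1.2.2, h2.2.1]
    have h8 : c * t + s ≤ 1 := by nlinarith
    nlinarith [mul_le_mul_of_nonneg_left h8 hs, mul_lt_mul_of_pos_left h6 hc, sq_nonneg (s - 1)]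
  all_goals linarith [h1.1.1, h1.1.2, h1.2.1, h1.2.2, h2.1.1, h2.1.2, h2.2.1, h2.2.2]

end IsUnitSq

/-! ### The legs of a right angle in a unit square. -/

/-- If a unit square contains the vertex of a right angle and the end point of one leg `x ≥ 1`, then
the other leg is at most `leg x`. -/
def leg (x : ℝ) : ℝ := x - x * √(x ^ 2 - 1)

/-- Put `A = c x` and `B = s x`, so `A² + B² = 1 + w²`. As `c y ≤ 1 - B`, the bound follows from `D
= B - 1 + A (1 - w) ≥ 0`. The identity `key` factors `D (B + w)` as `1 - A ≥ 0` times a positive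
number, so `D = 0` forces `A = 1` and then `B = w`. -/
lemma leg_aux {c s x y w : ℝ} (hc : 0 < c) (hs : 0 ≤ s) (hcs : c ^ 2 + s ^ 2 = 1) (hx : 1 ≤ x)
    (hy : 0 ≤ y) (hw : 0 ≤ w) (hxw : w ^ 2 = x ^ 2 - 1) (h1 : c * x ≤ 1)
    (h2 : c * y + s * x ≤ 1) :
    y ≤ x - x * w ∧ (y = x - x * w → c * x = 1 ∧ s * x = w) := by
  have hA : 0 < c * x := by positivity
  have hB : 0 ≤ s * x := by positivity
  have hAB : (c * x) ^ 2 + (s * x) ^ 2 = 1 + w ^ 2 := by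
    rw [hxw]; linear_combination x ^ 2 * hcs
  have hB1 : s * x ≤ 1 := by nlinarith
  have hwB : w ≤ s * x := abs_le_of_sq_le_sq' (by nlinarith) hB |>.2
  have hpos : 0 < (1 + c * x) - (1 - w) * (s * x + w) := by nlinarith
  have key : (s * x - w + w * (1 - c * x) - (1 - c * x)) * (s * x + w) =
      (1 - c * x) * ((1 + c * x) - (1 - w) * (s * x + w)) := by
    linear_combination hAB
  have hle : c * y ≤ c * (x - x * w) → y ≤ x - x * w := fun h => le_of_mul_le_mul_left h hc
  have hD : 0 ≤ s * x - w + w * (1 - c * x) - (1 - c * x) ∧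
      (s * x - w + w * (1 - c * x) - (1 - c * x) = 0 → c * x = 1) := by
    constructor
    · rcases (add_nonneg hB hw).eq_or_lt with h | h
      · have hw0 : w = 0 := by linarith
        have hB0 : s * x = 0 := by linarith
        rw [hw0, hB0] at hAB ⊢
        nlinarith
      · by_contra hneg
        have := mul_neg_of_neg_of_pos (not_le.1 hneg) h
        nlinarith [mul_nonneg (sub_nonneg.2 h1) hpos.le]
    · intro h
      rw [h, zero_mul, eq_comm, mul_eq_zero] at key
      rcases key with h' | h' <;> linarith
  refine ⟨hle (by nlinarith [hD.1]), fun h => ?_⟩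
  have hA1 : c * x = 1 := by
    refine hD.2 (le_antisymm ?_ hD.1)
    rw [h] at h2
    nlinarith
  refine ⟨hA1, ?_⟩
  rw [hA1] at hAB
  nlinarith

/-- The legs of a right angle in a unit square. -/
lemma IsUnitSq.leg_bound {m : ℝ → ℝ → Prop} (h : IsUnitSq m) {x y : ℝ} (hx : 1 ≤ x) (hy : 0 ≤ y)
    (h0 : m 0 0) (h1 : m x 0) (h2 : m 0 y) : y ≤ leg x := by
  obtain ⟨c, s, p, k, hc, hs, hcs, hm⟩ := h.normal_form
  rw [hm] at h0 h1 h2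
  exact (leg_aux hc hs hcs hx hy (Real.sqrt_nonneg _) (Real.sq_sqrt (by nlinarith))
    (by linarith [h0.1.1, h1.1.2]) (by linarith [h1.2.1, h2.2.2])).1

/-- If the legs are as long as possible, the unit square is determined. -/
lemma IsUnitSq.eq_of_leg_eq {m : ℝ → ℝ → Prop} (h : IsUnitSq m) {x y w : ℝ} (hx : 1 ≤ x)
    (hy : 0 ≤ y) (hw : 0 ≤ w) (hxw : w ^ 2 = x ^ 2 - 1) (hyx : y = x - x * w)
    (h0 : m 0 0) (h1 : m x 0) (h2 : m 0 y) (x' y' : ℝ) : m x' y' ↔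
      (0 ≤ x' + w * y' ∧ x' + w * y' ≤ x) ∧ (-(x * w) ≤ y' - w * x' ∧ y' - w * x' ≤ y) := by
  obtain ⟨c, s, p, k, hc, hs, hcs, hm⟩ := h.normal_form
  rw [hm] at h0 h1 h2
  obtain ⟨hc1, hs1⟩ := (leg_aux hc hs hcs hx hy hw hxw
    (by linarith [h0.1.1, h1.1.2]) (by linarith [h1.2.1, h2.2.2])).2 hyx
  have hx0 : 0 < x := by linarith
  have hp : p = 0 := le_antisymm (by linarith [h0.1.1]) (by linarith [h1.1.2])
  have hcy : c * y = 1 - w := by rw [hyx]; linear_combination (1 - w) * hc1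
  have hk : k = -w := le_antisymm (by linarith [h1.2.1]) (by linarith [h2.2.2])
  have e1 : x' + w * y' = x * (c * x' + s * y') := by
    linear_combination (-x') * hc1 - y' * hs1
  have e2 : y' - w * x' = x * (c * y' - s * x') := by
    linear_combination (-y') * hc1 + x' * hs1
  have e3 : y = x * (-w + 1) := by rw [hyx]; ring
  have e4 : -(x * w) = x * (-w) := by ring
  have e5 : (0 : ℝ) = x * 0 := by ring
  have e6 : x * (c * x' + s * y') ≤ x ↔ x * (c * x' + s * y') ≤ x * 1 := by rw [mul_one]
  rw [hm, hp, hk, e1, e2, e3, e4, e6, mul_le_mul_iff_right₀ hx0, mul_le_mul_iff_right₀ hx0,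
    mul_le_mul_iff_right₀ hx0, mul_nonneg_iff_of_pos_left hx0, zero_add]

/-- If two closed sets on a line cover a segment and each contains one of its end points, they
meet in the segment. -/
lemma exists_mem_both {f g : ℝ → Prop} (hf : IsClosed {x | f x}) (hg : IsClosed {x | g x}) {a : ℝ}
    (ha : 0 ≤ a) (h0 : f 0) (h1 : g a) (h : ∀ x, 0 ≤ x → x ≤ a → f x ∨ g x) :
    ∃ x, (0 ≤ x ∧ x ≤ a) ∧ f x ∧ g x :=
  isPreconnected_closed_iff.1 isPreconnected_Icc _ _ hf hg (fun x hx => h x hx.1 hx.2)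
    ⟨0, ⟨le_rfl, ha⟩, h0⟩ ⟨a, ⟨ha, le_rfl⟩, h1⟩

/-! ### Existence of the maxima by compactness. -/

/-- The unit square with direction `(c, s)` and offsets `p`, `k`, where `q = (c, s, p, k)`. -/
def regionOf (q : ℝ × ℝ × ℝ × ℝ) (x y : ℝ) : Prop :=
  (q.2.2.1 ≤ q.1 * x + q.2.1 * y ∧ q.1 * x + q.2.1 * y ≤ q.2.2.1 + 1) ∧
    (q.2.2.2 ≤ q.1 * y - q.2.1 * x ∧ q.1 * y - q.2.1 * x ≤ q.2.2.2 + 1)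

lemma isUnitSq_unit : IsUnitSq fun x y => (0 ≤ x ∧ x ≤ 1) ∧ (0 ≤ y ∧ y ≤ 1) :=
  ⟨1, 0, 0, 0, by norm_num, fun x y => by simp⟩

/-- Otherwise two of the `n + 1` points `0, 2, …, 2n` would lie in the same square, whose diameter
is less than 2. -/
lemma edge_lt_of_covers_bottom {n : ℕ} {m : Fin n → ℝ → ℝ → Prop} (hm : ∀ i, IsUnitSq (m i))
    {a : ℝ} (h : ∀ x, 0 ≤ x → x ≤ a → ∃ i, m i x 0) : a < 2 * n := by
  by_contra hlt
  push Not at hlt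
  have hj : ∀ j : Fin (n + 1), ∃ i, m i (2 * (j : ℕ)) 0 := fun j => by
    refine h _ (by positivity) (le_trans ?_ hlt)
    have : ((j : ℕ) : ℝ) ≤ n := by exact_mod_cast Nat.lt_succ_iff.1 j.2
    linarith
  choose f hf using hj
  obtain ⟨j, j', hne, he⟩ := Fintype.exists_ne_map_eq_of_card_lt f (by simp)
  have h1 := (hm (f j)).sq_add_sq_le (hf j) (he ▸ hf j')
  have hne' : ((j : ℕ) : ℤ) - (j' : ℕ) ≠ 0 := by
    intro h0
    exact hne (Fin.ext (by omega))
  have h2 : (1 : ℤ) ≤ (((j : ℕ) : ℤ) - (j' : ℕ)) ^ 2 := by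
    have := sq_pos_of_ne_zero hne'
    omega
  have h3 : (1 : ℝ) ≤ (((j : ℕ) : ℝ) - (j' : ℕ)) ^ 2 := by exact_mod_cast h2
  nlinarith

/-- Among the `a` such that `n` unit squares cover the copy of `Z` enlarged by the factor `a` there
is a greatest one. -/
theorem exists_isGreatest_scale (Z : ℝ → ℝ → Prop)
    (hZ : ∀ x y, Z x y → (0 ≤ x ∧ x ≤ 1) ∧ (0 ≤ y ∧ y ≤ 1))
    (hbot : ∀ x, 0 ≤ x → x ≤ 1 → Z x 0) {n : ℕ} (hn : 0 < n) :
    ∃ M, IsGreatest {a : ℝ | 0 < a ∧ ∃ m : Fin n → ℝ → ℝ → Prop, (∀ i, IsUnitSq (m i)) ∧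
      ∀ x y, Z x y → ∃ i, m i (a * x) (a * y)} M := by
  -- For a square meeting the enlarged set, each of the two strip coordinates of a common point is a
  -- sum of two terms of size at most `2n`; the offset lies within 1 of it.
  set R : ℝ := 4 * n + 1 with hR
  have hn1 : (1 : ℝ) ≤ n := by exact_mod_cast hn
  set K : Set (ℝ × (Fin n → ℝ × ℝ × ℝ × ℝ)) := Icc 1 (2 * n : ℝ) ×ˢ
    Set.univ.pi (fun _ => Icc (-1) 1 ×ˢ Icc (-1) 1 ×ˢ Icc (-R) R ×ˢ Icc (-R) R) with hK
  have hKc : IsCompact K := isCompact_Icc.prod (isCompact_univ_pi fun _ =>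
    isCompact_Icc.prod (isCompact_Icc.prod (isCompact_Icc.prod isCompact_Icc)))
  set C : Set (ℝ × (Fin n → ℝ × ℝ × ℝ × ℝ)) :=
    {P | (∀ i, (P.2 i).1 ^ 2 + (P.2 i).2.1 ^ 2 = 1) ∧
      ∀ x y, Z x y → ∃ i, regionOf (P.2 i) (P.1 * x) (P.1 * y)} with hC
  have hCc : IsClosed C := by
    -- The points `(x, y)` range over the unscaled set, which does not depend on `a`. Hence `C` is
    -- an intersection of finite unions of closed conditions on the parameters.
    have e : C = (⋂ i, {P | (P.2 i).1 ^ 2 + (P.2 i).2.1 ^ 2 = 1}) ∩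
        ⋂ x, ⋂ y, ⋂ (_ : Z x y), ⋃ i,
          {P : ℝ × (Fin n → ℝ × ℝ × ℝ × ℝ) | regionOf (P.2 i) (P.1 * x) (P.1 * y)} := by
      ext P
      simp [hC]
    rw [e]
    refine (isClosed_iInter fun i => isClosed_eq (by fun_prop) (by fun_prop)).inter
      (isClosed_iInter fun x => isClosed_iInter fun y => isClosed_iInter fun _ =>
        isClosed_iUnion_of_finite fun i => ?_)
    refine IsClosed.and (IsClosed.and ?_ ?_) (IsClosed.and ?_ ?_)
    all_goals exact isClosed_le (by fun_prop) (by fun_prop)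
  have hcomp : IsCompact (Prod.fst '' (K ∩ C)) := (hKc.inter_right hCc).image continuous_fst
  have hne : (Prod.fst '' (K ∩ C)).Nonempty := by
    refine ⟨1, (1, fun _ => (1, 0, 0, 0)), ⟨⟨⟨le_rfl, by linarith⟩, fun i _ => ?_⟩, ?_, ?_⟩, rfl⟩
    · have : 0 ≤ R := by linarith
      simp [this]
    · simp
    · intro x y hxy
      exact ⟨⟨0, hn⟩, by simpa [regionOf] using hZ x y hxy⟩
  obtain ⟨M, hM⟩ := hcomp.exists_isGreatest hne
  obtain ⟨⟨P, ⟨hPK, hPC⟩, rfl⟩, hub⟩ := hM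
  refine ⟨P.1, ⟨by linarith [hPK.1.1], fun i => regionOf (P.2 i), fun i =>
    ⟨_, _, _, _, hPC.1 i, fun x y => Iff.rfl⟩, hPC.2⟩, ?_⟩
  rintro a ⟨ha, m, hm, hcov⟩
  rcases le_or_gt a 1 with h1 | h1
  · exact h1.trans hPK.1.1
  have ha2 : a < 2 * n := edge_lt_of_covers_bottom hm fun x hx hxa => by
    simpa [mul_div_cancel₀ _ ha.ne'] using
      hcov (x / a) 0 (hbot _ (by positivity) ((div_le_one ha).2 hxa))
  have hq : ∀ i, ∃ q : ℝ × ℝ × ℝ × ℝ, q ∈ Icc (-1 : ℝ) 1 ×ˢ Icc (-1 : ℝ) 1 ×ˢ Icc (-R) R ×ˢ Icc (-R) R ∧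
      q.1 ^ 2 + q.2.1 ^ 2 = 1 ∧ ∀ x y, Z x y → m i (a * x) (a * y) →
        regionOf q (a * x) (a * y) := by
    intro i
    by_cases hi : ∃ x y, Z x y ∧ m i (a * x) (a * y)
    · obtain ⟨x, y, hxy, hmi⟩ := hi
      obtain ⟨c, s, p, k, hcs, hmm⟩ := hm i
      rw [hmm] at hmi
      have hc : -1 ≤ c ∧ c ≤ 1 := abs_le.1 (by rw [← sq_le_one_iff_abs_le_one]; nlinarith)
      have hs : -1 ≤ s ∧ s ≤ 1 := abs_le.1 (by rw [← sq_le_one_iff_abs_le_one]; nlinarith)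
      obtain ⟨⟨hx0, hx1⟩, hy0, hy1⟩ := hZ x y hxy
      have hX0 : 0 ≤ a * x := by positivity
      have hY0 : 0 ≤ a * y := by positivity
      have hX1 : a * x ≤ 2 * n := by nlinarith
      have hY1 : a * y ≤ 2 * n := by nlinarith
      have b1 : c * (a * x) ≤ 2 * n := by nlinarith
      have b2 : -(2 * n) ≤ c * (a * x) := by nlinarith
      have b3 : s * (a * y) ≤ 2 * n := by nlinarith
      have b4 : -(2 * n) ≤ s * (a * y) := by nlinarith
      have b5 : c * (a * y) ≤ 2 * n := by nlinarith
      have b6 : -(2 * n) ≤ c * (a * y) := by nlinarith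
      have b7 : s * (a * x) ≤ 2 * n := by nlinarith
      have b8 : -(2 * n) ≤ s * (a * x) := by nlinarith
      obtain ⟨⟨m1, m2⟩, m3, m4⟩ := hmi
      refine ⟨(c, s, p, k), ⟨hc, hs, ⟨?_, ?_⟩, ?_, ?_⟩, hcs, fun x y _ h => (hmm _ _).1 h⟩ <;>
        simp only [hR] <;> linarith
    -- A square that misses the set may have arbitrarily large offsets, so it is replaced by a fixed
    -- one.
    · refine ⟨(1, 0, 0, 0), ?_, by norm_num, fun x y hxy h => (hi ⟨x, y, hxy, h⟩).elim⟩
      have : 0 ≤ R := by linarith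
      simp [this]
  choose q hqK hq1 hq2 using hq
  refine hub ⟨(a, q), ⟨⟨⟨h1.le, ha2.le⟩, fun i _ => hqK i⟩, hq1, fun x y hxy => ?_⟩, rfl⟩
  obtain ⟨i, hi⟩ := hcov x y hxy
  exact ⟨i, hq2 i x y hxy hi⟩

lemma coversBd_iff_scale {ι : Type*} {m : ι → ℝ → ℝ → Prop} {a : ℝ} (ha : 0 < a) :
    CoversBd m a ↔ ∀ x y, OnBd 1 x y → ∃ i, m i (a * x) (a * y) := by
  constructor
  · intro h x y hxy
    apply h
    rcases hxy with ⟨⟨h1, h2⟩, h | h⟩ | ⟨⟨h1, h2⟩, h | h⟩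
    · exact .inl ⟨⟨by positivity, by nlinarith⟩, .inl (by simp [h])⟩
    · exact .inl ⟨⟨by positivity, by nlinarith⟩, .inr (by simp [h])⟩
    · exact .inr ⟨⟨by positivity, by nlinarith⟩, .inl (by simp [h])⟩
    · exact .inr ⟨⟨by positivity, by nlinarith⟩, .inr (by simp [h])⟩
  · intro h x y hxy
    have key := h (x / a) (y / a) ?_
    · simpa [mul_div_cancel₀ _ ha.ne'] using key
    rcases hxy with ⟨⟨h1, h2⟩, h | h⟩ | ⟨⟨h1, h2⟩, h | h⟩
    · exact .inl ⟨⟨by positivity, (div_le_one ha).2 h2⟩, .inl (by simp [h])⟩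
    · exact .inl ⟨⟨by positivity, (div_le_one ha).2 h2⟩, .inr (by simp [h, ha.ne'])⟩
    · exact .inr ⟨⟨by positivity, (div_le_one ha).2 h2⟩, .inl (by simp [h])⟩
    · exact .inr ⟨⟨by positivity, (div_le_one ha).2 h2⟩, .inr (by simp [h, ha.ne'])⟩

lemma isGreatest_Sbd {n : ℕ} (hn : 0 < n) : IsGreatest (bdCoverableEdges n) (Sbd n) := by
  obtain ⟨M, hM⟩ := exists_isGreatest_scale (OnBd 1)
    (by
      rintro x y (⟨⟨h1, h2⟩, h | h⟩ | ⟨⟨h1, h2⟩, h | h⟩) <;> subst h <;>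
        refine ⟨⟨?_, ?_⟩, ?_, ?_⟩ <;> linarith)
    (fun x h1 h2 => .inl ⟨⟨h1, h2⟩, .inl rfl⟩) hn
  have e : bdCoverableEdges n = {a : ℝ | 0 < a ∧ ∃ m : Fin n → ℝ → ℝ → Prop,
      (∀ i, IsUnitSq (m i)) ∧ ∀ x y, OnBd 1 x y → ∃ i, m i (a * x) (a * y)} := by
    ext a
    rw [mem_bdCoverableEdges]
    refine and_congr_right fun ha => ?_
    simp only [coversBd_iff_scale ha]
  rw [Sbd, e, hM.csSup_eq]
  exact hM

lemma isGreatest_S {n : ℕ} (hn : 0 < n) : IsGreatest (coverableEdges n) (S n) := by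
  obtain ⟨M, hM⟩ := exists_isGreatest_scale (fun x y => (0 ≤ x ∧ x ≤ 1) ∧ (0 ≤ y ∧ y ≤ 1))
    (fun x y h => h) (fun x h1 h2 => ⟨⟨h1, h2⟩, le_rfl, zero_le_one⟩) hn
  have e : coverableEdges n = {a : ℝ | 0 < a ∧ ∃ m : Fin n → ℝ → ℝ → Prop,
      (∀ i, IsUnitSq (m i)) ∧ ∀ x y, ((0 ≤ x ∧ x ≤ 1) ∧ (0 ≤ y ∧ y ≤ 1)) →
        ∃ i, m i (a * x) (a * y)} := by
    ext a
    rw [mem_coverableEdges]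
    refine and_congr_right fun ha => exists_congr fun m => and_congr_right fun _ => ?_
    constructor
    · rintro h x y ⟨⟨h1, h2⟩, h3, h4⟩
      exact h _ _ ⟨⟨by positivity, by nlinarith⟩, by positivity, by nlinarith⟩
    · rintro h x y ⟨⟨h1, h2⟩, h3, h4⟩
      simpa [mul_div_cancel₀ _ ha.ne'] using h (x / a) (y / a)
        ⟨⟨by positivity, (div_le_one ha).2 h2⟩, by positivity, (div_le_one ha).2 h4⟩
  rw [S, e, hM.csSup_eq]
  exact hM

/-- A cover by fewer than `n` squares becomes one by `n` squares through repetition. -/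
lemma le_Sbd {ι : Type*} [Fintype ι] {n : ℕ} (hn : 0 < n) (hι : Fintype.card ι ≤ n)
    {m : ι → ℝ → ℝ → Prop} (hm : ∀ i, IsUnitSq (m i)) {a : ℝ} (ha : 0 < a) (h : CoversBd m a) :
    a ≤ Sbd n := by
  refine (isGreatest_Sbd hn).2 (mem_bdCoverableEdges.2 ⟨ha, ?_⟩)
  obtain ⟨f⟩ : Nonempty (ι ↪ Fin n) := Function.Embedding.nonempty_of_card_le (by simpa)
  have hne : Nonempty ι := by
    obtain ⟨i, -⟩ := h 0 0 (.inl ⟨⟨le_rfl, ha.le⟩, .inl rfl⟩)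
    exact ⟨i⟩
  refine ⟨fun j => m (Function.invFun f j), fun j => hm _, fun x y hxy => ?_⟩
  obtain ⟨i, hi⟩ := h x y hxy
  refine ⟨f i, ?_⟩
  simpa only [Function.leftInverse_invFun f.injective i] using hi

/-! ### Cutting and reassembling the boundary: the recursion with step four. -/

/-- The region meets the left side of `[0, a]²`. -/
def MeetsLeft (a : ℝ) (m : ℝ → ℝ → Prop) : Prop := ∃ y, (0 ≤ y ∧ y ≤ a) ∧ m 0 y

/-- The region meets the right side of `[0, a]²`. -/
def MeetsRight (a : ℝ) (m : ℝ → ℝ → Prop) : Prop := ∃ y, (0 ≤ y ∧ y ≤ a) ∧ m a y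

/-- The regions `m i` are split into two classes, the first containing those that meet the left side
of `[0, a]²` and the second those that meet the right side, such that the first class, the second
one translated by `a' - a`, and `G` cover the bottom side of `[0, a']²`. -/
def BottomSplit {ι : Type*} (m : ι → ℝ → ℝ → Prop) (a a' : ℝ) (G : ℝ → ℝ → Prop) : Prop :=
  ∃ χ : ι → Prop, (∀ i, MeetsLeft a (m i) → ¬ χ i) ∧ (∀ i, MeetsRight a (m i) → χ i) ∧
    ∀ x, 0 ≤ x → x ≤ a' → G x 0 ∨ (∃ i, ¬ χ i ∧ x ≤ a ∧ m i x 0) ∨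
      ∃ i, χ i ∧ 0 ≤ x - (a' - a) ∧ m i (x - (a' - a)) 0

lemma IsUnitSq.not_opposite {m : ℝ → ℝ → Prop} (h : IsUnitSq m) {a : ℝ} (ha : √2 < a)
    {x x' : ℝ} (h1 : m x 0) (h2 : m x' a) : False := by
  linarith [h.sub_le_sqrt_two' h1 h2]

lemma IsUnitSq.not_opposite' {m : ℝ → ℝ → Prop} (h : IsUnitSq m) {a : ℝ} (ha : √2 < a)
    {y y' : ℝ} (h1 : m 0 y) (h2 : m a y') : False := by
  linarith [h.sub_le_sqrt_two h1 h2]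

lemma exists_piecewise {ι : Type*} (P A B : ι → Prop) :
    ∃ X : ι → Prop, ∀ i, (P i → (X i ↔ A i)) ∧ (¬ P i → (X i ↔ B i)) :=
  ⟨fun i => (P i ∧ A i) ∨ (¬ P i ∧ B i), fun i => by tauto⟩

/-- Splittings of the four sides of `[0, a]²` give a covering of the boundary of `[0, a']²`. -/
lemma exists_translates {ι : Type*} {m : ι → ℝ → ℝ → Prop} (hm : ∀ i, IsUnitSq (m i)) {a a' : ℝ}
    (ha : √2 < a) {G₁ G₂ G₃ G₄ : ℝ → ℝ → Prop}
    (hb : BottomSplit m a a' G₁)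
    (hl : BottomSplit (fun i x y => m i y x) a a' G₂)
    (ht : BottomSplit (fun i x y => m i x (a - y)) a a' G₃)
    (hr : BottomSplit (fun i x y => m i (a - y) x) a a' G₄) :
    ∃ d e : ι → ℝ, ∀ x y, OnBd a' x y →
      (∃ i, m i (x - d i) (y - e i)) ∨ G₁ x y ∨ G₂ y x ∨ G₃ x (a' - y) ∨ G₄ y (a' - x) := by
  classical
  obtain ⟨χb, hb1, hb2, hb⟩ := hb
  obtain ⟨χl, hl1, hl2, hl⟩ := hl
  obtain ⟨χt, ht1, ht2, ht⟩ := ht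
  obtain ⟨χr, hr1, hr2, hr⟩ := hr
  simp only [MeetsLeft, MeetsRight] at hb1 hb2 hl1 hl2 ht1 ht2 hr1 hr2
  -- `X i` and `Y i` decide whether square `i` moves by `a' - a` horizontally and vertically. No
  -- square meets opposite sides, so the two splittings behind each choice do not conflict. A square
  -- meeting the left side is kept there by either splitting behind `X`, so it can only slide along
  -- this side; likewise for the other sides.
  obtain ⟨X, hX⟩ := exists_piecewise (fun i => ∃ x, (0 ≤ x ∧ x ≤ a) ∧ m i x 0) χb χt
  obtain ⟨Y, hY⟩ := exists_piecewise (fun i => ∃ y, (0 ≤ y ∧ y ≤ a) ∧ m i 0 y) χl χr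
  have left : ∀ i y, 0 ≤ y → y ≤ a → m i 0 y → (Y i ↔ χl i) ∧ ¬ X i := by
    intro i y h0 h1 h
    have h2 : ∃ y, (0 ≤ y ∧ y ≤ a) ∧ m i 0 y := ⟨y, ⟨h0, h1⟩, h⟩
    have c1 := hb1 i h2
    have c2 := ht1 i ⟨a - y, ⟨by linarith, by linarith⟩, by simpa using h⟩
    obtain ⟨x1, x2⟩ := hX i
    refine ⟨(hY i).1 h2, ?_⟩
    tauto
  have right : ∀ i y, 0 ≤ y → y ≤ a → m i a y → (Y i ↔ χr i) ∧ X i := by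
    intro i y h0 h1 h
    have h2 : ¬ ∃ y, (0 ≤ y ∧ y ≤ a) ∧ m i 0 y := by
      rintro ⟨y', -, h'⟩
      exact (hm i).not_opposite' ha h' h
    have c1 := hb2 i ⟨y, ⟨h0, h1⟩, h⟩
    have c2 := ht2 i ⟨a - y, ⟨by linarith, by linarith⟩, by simpa using h⟩
    obtain ⟨x1, x2⟩ := hX i
    refine ⟨(hY i).2 h2, ?_⟩
    tauto
  have bottom : ∀ i x, 0 ≤ x → x ≤ a → m i x 0 → (X i ↔ χb i) ∧ ¬ Y i := by
    intro i x h0 h1 h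
    have h2 : ∃ x, (0 ≤ x ∧ x ≤ a) ∧ m i x 0 := ⟨x, ⟨h0, h1⟩, h⟩
    have c1 := hl1 i h2
    have c2 := hr1 i ⟨a - x, ⟨by linarith, by linarith⟩, by simpa using h⟩
    obtain ⟨x1, x2⟩ := hY i
    refine ⟨(hX i).1 h2, ?_⟩
    tauto
  have top : ∀ i x, 0 ≤ x → x ≤ a → m i x a → (X i ↔ χt i) ∧ Y i := by
    intro i x h0 h1 h
    have h2 : ¬ ∃ x, (0 ≤ x ∧ x ≤ a) ∧ m i x 0 := by
      rintro ⟨y', -, h'⟩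
      exact (hm i).not_opposite ha h' h
    have c1 := hl2 i ⟨x, ⟨h0, h1⟩, h⟩
    have c2 := hr2 i ⟨a - x, ⟨by linarith, by linarith⟩, by simpa using h⟩
    obtain ⟨x1, x2⟩ := hY i
    refine ⟨(hX i).2 h2, ?_⟩
    tauto
  refine ⟨fun i => if X i then a' - a else 0, fun i => if Y i then a' - a else 0, ?_⟩
  rintro x y (⟨⟨h1, h2⟩, rfl | rfl⟩ | ⟨⟨h1, h2⟩, rfl | rfl⟩)
  · rcases hb x h1 h2 with h | ⟨i, hi, hx, h⟩ | ⟨i, hi, hx, h⟩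
    · exact .inr (.inl h)
    · obtain ⟨c1, c2⟩ := bottom i x h1 hx h
      exact .inl ⟨i, by simpa [c1, c2, hi] using h⟩
    · obtain ⟨c1, c2⟩ := bottom i _ hx (by linarith) h
      exact .inl ⟨i, by simpa [c1, c2, hi] using h⟩
  · rcases ht x h1 h2 with h | ⟨i, hi, hx, h⟩ | ⟨i, hi, hx, h⟩
    · exact .inr (.inr (.inr (.inl (by simpa using h))))
    · rw [sub_zero] at h
      obtain ⟨c1, c2⟩ := top i x h1 hx h
      exact .inl ⟨i, by simpa [c1, c2, hi] using h⟩
    · rw [sub_zero] at h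
      obtain ⟨c1, c2⟩ := top i _ hx (by linarith) h
      exact .inl ⟨i, by simpa [c1, c2, hi] using h⟩
  · rcases hl y h1 h2 with h | ⟨i, hi, hx, h⟩ | ⟨i, hi, hx, h⟩
    · exact .inr (.inr (.inl h))
    · obtain ⟨c1, c2⟩ := left i y h1 hx h
      exact .inl ⟨i, by simpa [c1, c2, hi] using h⟩
    · obtain ⟨c1, c2⟩ := left i _ hx (by linarith) h
      exact .inl ⟨i, by simpa [c1, c2, hi] using h⟩
  · rcases hr y h1 h2 with h | ⟨i, hi, hx, h⟩ | ⟨i, hi, hx, h⟩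
    · exact .inr (.inr (.inr (.inr (by simpa using h))))
    · rw [sub_zero] at h
      obtain ⟨c1, c2⟩ := right i y h1 hx h
      exact .inl ⟨i, by simpa [c1, c2, hi] using h⟩
    · rw [sub_zero] at h
      obtain ⟨c1, c2⟩ := right i _ hx (by linarith) h
      exact .inl ⟨i, by simpa [c1, c2, hi] using h⟩

lemma CoversBd.sides {ι : Type*} {m : ι → ℝ → ℝ → Prop} {a : ℝ} (h : CoversBd m a) :
    (∀ x, 0 ≤ x → x ≤ a → ∃ i, m i x 0) ∧ (∀ x, 0 ≤ x → x ≤ a → ∃ i, m i 0 x) ∧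
    (∀ x, 0 ≤ x → x ≤ a → ∃ i, m i x a) ∧ (∀ x, 0 ≤ x → x ≤ a → ∃ i, m i a x) :=
  ⟨fun _ h1 h2 => h _ _ (.inl ⟨⟨h1, h2⟩, .inl rfl⟩), fun _ h1 h2 => h _ _ (.inr ⟨⟨h1, h2⟩, .inl rfl⟩),
    fun _ h1 h2 => h _ _ (.inl ⟨⟨h1, h2⟩, .inr rfl⟩),
    fun _ h1 h2 => h _ _ (.inr ⟨⟨h1, h2⟩, .inr rfl⟩)⟩

lemma sqrt_two_lt : √2 < 3 / 2 := by
  rw [Real.sqrt_lt' (by norm_num)]; norm_num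

lemma lt_sqrt_two : 7 / 5 < √2 := by
  rw [Real.lt_sqrt (by norm_num)]; norm_num

lemma exists_unitSq_diagonal (c : ℝ) :
    ∃ G, IsUnitSq G ∧ ∀ x, c ≤ x → x ≤ c + √2 → G x 0 := by
  have h2 : √2 * √2 = 2 := Real.mul_self_sqrt (by norm_num)
  refine ⟨_, ⟨√2 / 2, √2 / 2, √2 / 2 * c, -(√2 / 2 * c) - 1, by nlinarith, fun x y => Iff.rfl⟩,
    fun x h3 h4 => ?_⟩
  have h5 : 0 ≤ √2 / 2 * (x - c) := mul_nonneg (by positivity) (by linarith)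
  have h6 : √2 / 2 * (x - c) ≤ √2 / 2 * √2 := mul_le_mul_of_nonneg_left (by linarith) (by positivity)
  refine ⟨⟨?_, ?_⟩, ?_, ?_⟩ <;> linarith

/-- On the bottom side, a unit square that meets the right side is not followed by one that meets
the left side. -/
lemma mem_right_of_left {m m' : ℝ → ℝ → Prop} (hm : IsUnitSq m) (hm' : IsUnitSq m') {a u x : ℝ}
    (ha : 2 ≤ a) (hl : MeetsLeft a m) (hr : MeetsRight a m') (hu : m' u 0) (hu' : ¬ m u 0)
    (hux : u < x) (hx : m x 0) : m' x 0 := by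
  obtain ⟨y, ⟨hy0, -⟩, hy⟩ := hl
  obtain ⟨z, ⟨hz0, -⟩, hz⟩ := hr
  have hua : a - √2 ≤ u := by linarith [hm'.sub_le_sqrt_two hu hz]
  -- If `x > 1`, then `m` contains the segment from `1 / 2` to `x`, and hence `u ≥ a - √2 ≥ 1 / 2`.
  have hx1 : x ≤ 1 := by
    by_contra hlt
    exact hu' (hm.convex (hm.half_mem hy0 (not_le.1 hlt) hy hx) hx
      (by linarith [sqrt_two_lt]) hux.le)
  -- Seen from the right end, `m'` contains the segment from `u` to `a - 1 / 2`, and `x ≤ 1` lies in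
  -- it.
  have h := (hm'.flip a).half_mem (t := z) (z := a - u) hz0 (by linarith) (by simpa using hz)
    (by simpa using hu)
  exact hm'.convex hu h hux.le (by linarith)

/-- The bottom side can be cut so that a square with a diagonal on this side fits in between. -/
lemma exists_bottomSplit_expand {ι : Type*} {m : ι → ℝ → ℝ → Prop} (hm : ∀ i, IsUnitSq (m i))
    {a : ℝ} (ha : 2 ≤ a) (h : ∀ x, 0 ≤ x → x ≤ a → ∃ i, m i x 0) :
    ∃ G, IsUnitSq G ∧ BottomSplit m a (a + √2) G := by
  have ha2 : √2 < a := by linarith [sqrt_two_lt]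
  -- The left class must cover `[0, c)` and the right class `(c, a]`. The cut point itself may stay
  -- uncovered by both, because the inserted diagonal occupies the closed segment `[c, c + √2]`.
  suffices hs : ∃ c, ∃ χ : ι → Prop, (∀ i, MeetsLeft a (m i) → ¬ χ i) ∧
      (∀ i, MeetsRight a (m i) → χ i) ∧ 0 ≤ c ∧
      (∀ x, 0 ≤ x → x < c → ∃ i, ¬ χ i ∧ x ≤ a ∧ m i x 0) ∧
      (∀ x, 0 ≤ x → c < x → x ≤ a → ∃ i, χ i ∧ m i x 0) by
    obtain ⟨c, χ, h1, h2, hc, h3, h4⟩ := hs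
    obtain ⟨G, hG, hG'⟩ := exists_unitSq_diagonal c
    refine ⟨G, hG, χ, h1, h2, fun x hx0 hx1 => ?_⟩
    rcases lt_or_ge x c with hxc | hxc
    · obtain ⟨i, hi, hi'⟩ := h3 x hx0 hxc
      exact .inr (.inl ⟨i, hi, hi'⟩)
    rcases le_or_gt x (c + √2) with hxc' | hxc'
    · exact .inl (hG' x hxc hxc')
    · have hx : 0 ≤ x - √2 := by linarith
      obtain ⟨i, hi, hi'⟩ := h4 (x - √2) hx (by linarith) (by linarith)
      exact .inr (.inr ⟨i, hi, by simpa using hx, by simpa using hi'⟩)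
  have hlr : ∀ i, MeetsLeft a (m i) → ¬ MeetsRight a (m i) := by
    rintro i ⟨y, -, hy⟩ ⟨z, -, hz⟩
    exact (hm i).not_opposite' ha2 hy hz
  -- These points are covered only by squares meeting the right side; the cut is made at the
  -- infimum.
  set N : Set ℝ := {x | (0 ≤ x ∧ x ≤ a) ∧ ∀ i, ¬ MeetsRight a (m i) → ¬ m i x 0} with hN
  rcases N.eq_empty_or_nonempty with hNe | hNe
  · refine ⟨a, fun i => MeetsRight a (m i), hlr, fun i hi => hi, by linarith, fun x h0 h1 => ?_,
      fun x _ h1 h2 => absurd h1 (not_lt.2 h2)⟩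
    by_contra hc
    push Not at hc
    have hxN : x ∈ N := ⟨⟨h0, h1.le⟩, fun i hi => hc i hi h1.le⟩
    simp [hNe] at hxN
  · have hbdd : BddBelow N := ⟨0, fun x hx => hx.1.1⟩
    obtain ⟨n₀, hn₀⟩ := hNe
    refine ⟨sInf N, fun i => MeetsRight a (m i) ∨ (¬ MeetsLeft a (m i) ∧
      ∀ x, m i x 0 → sInf N ≤ x), ?_, fun i hi => .inl hi, Real.sInf_nonneg fun x hx => hx.1.1, ?_, ?_⟩
    · rintro i hi (h' | h')
      exacts [hlr i hi h', h'.1 hi]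
    · intro x h0 h1
      have hxN : x ∉ N := notMem_of_lt_csInf h1 hbdd
      have hxa : x ≤ a := h1.le.trans ((csInf_le hbdd hn₀).trans hn₀.1.2)
      have : ∃ i, ¬ MeetsRight a (m i) ∧ m i x 0 := by
        by_contra hc
        push Not at hc
        exact hxN ⟨⟨h0, hxa⟩, hc⟩
      obtain ⟨i, hi, hi'⟩ := this
      refine ⟨i, ?_, hxa, hi'⟩
      rintro (h' | h')
      exacts [hi h', absurd h1 (not_lt.2 (h'.2 x hi'))]
    · intro x h0 h1 h2
      obtain ⟨u, huN, hux⟩ := (csInf_lt_iff hbdd ⟨n₀, hn₀⟩).1 h1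
      obtain ⟨i, hi⟩ := h x h0 h2
      by_cases hr : MeetsRight a (m i)
      · exact ⟨i, .inl hr, hi⟩
      have hui : ¬ m i u 0 := huN.2 i hr
      by_cases hl : MeetsLeft a (m i)
      · obtain ⟨j, hj⟩ := h u huN.1.1 huN.1.2
        have hjr : MeetsRight a (m j) := by
          by_contra hjr
          exact huN.2 j hjr hj
        exact ⟨j, .inl hjr, mem_right_of_left (hm i) (hm j) ha hl hjr hj hui hux hi⟩
      · refine ⟨i, .inr ⟨hl, fun x' hx' => ?_⟩, hi⟩
        by_contra hlt
        push Not at hlt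
        exact hui ((hm i).convex hx' hi (hlt.le.trans (csInf_le hbdd huN)) hux.le)

/-- A unit square that covers the midpoint of the bottom side can be taken out so that the others,
moved together, still cover the rest of the side. -/
lemma exists_bottomSplit_shrink {ι : Type*} [Finite ι] {m : ι → ℝ → ℝ → Prop}
    (hm : ∀ i, IsUnitSq (m i)) {a δ : ℝ} (ha : 3 ≤ a) (hδ : √2 < δ) (hδ' : δ ≤ 2)
    (h : ∀ x, 0 ≤ x → x ≤ a → ∃ i, m i x 0) :
    ∃ i₀, m i₀ (a / 2) 0 ∧ ∀ s : Finset ι, (∀ i ∉ s, i = i₀ ∨ ∀ x, ¬ m i x 0) →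
      BottomSplit (fun i : s => m i) a (a - δ) fun _ _ => False := by
  have h2 := sqrt_two_lt
  have hs0 := Real.sqrt_nonneg 2
  have ha2 : √2 < a := by linarith
  have hbdd : ∀ i, BddBelow {x | m i x 0} := by
    intro i
    by_cases hi : ∃ z, m i z 0
    · obtain ⟨z, hz⟩ := hi
      exact ⟨z - √2, fun x hx => by linarith [(hm i).sub_le_sqrt_two hx hz]⟩
    · push Not at hi
      exact ⟨0, fun x hx => (hi x hx).elim⟩
  -- Among the squares over the midpoint, `i₀` reaches furthest left on the side. By convexity no
  -- square then has points on the side both left of `c` and beyond the midpoint, so the cut at `c`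
  -- separates the others.
  obtain ⟨i₀, hi₀, hmin⟩ := Set.exists_min_image {i | m i (a / 2) 0} (fun i => sInf {x | m i x 0})
    (Set.toFinite _) (h (a / 2) (by linarith) (by linarith))
  refine ⟨i₀, hi₀, fun s hs => ?_⟩
  set c := sInf {x | m i₀ x 0} with hc
  have hca : c ≤ a / 2 := csInf_le (hbdd i₀) hi₀
  have hcx : ∀ x, m i₀ x 0 → c ≤ x ∧ x ≤ c + √2 := fun x hx =>
    ⟨csInf_le (hbdd i₀) hx, by
      have : x - √2 ≤ c := le_csInf ⟨_, hi₀⟩ fun z hz => by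
        linarith [(hm i₀).sub_le_sqrt_two hz hx]
      linarith⟩
  have hlr : ∀ i, MeetsLeft a (m i) → ¬ MeetsRight a (m i) := by
    rintro i ⟨y, -, hy⟩ ⟨z, -, hz⟩
    exact (hm i).not_opposite' ha2 hy hz
  have hmem : ∀ i x, m i x 0 → ¬ m i₀ x 0 → i ∈ s := by
    intro i x hi hx
    by_contra his
    rcases hs i his with rfl | h'
    exacts [hx hi, h' x hi]
  refine ⟨fun i => MeetsRight a (m i) ∨ (¬ MeetsLeft a (m i) ∧ ∀ x, m i x 0 → c ≤ x), ?_,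
    fun i hi => .inl hi, fun x hx0 hx1 => .inr ?_⟩
  · rintro i hi (h' | h')
    exacts [hlr i hi h', h'.1 hi]
  rcases lt_or_ge x c with hxc | hxc
  · left
    obtain ⟨i, hi⟩ := h x hx0 (by linarith)
    refine ⟨⟨i, hmem i x hi fun h' => by linarith [(hcx x h').1]⟩, ?_, by linarith, hi⟩
    rintro (⟨y, -, hy⟩ | h')
    · have := (hm i).sub_le_sqrt_two hi hy
      linarith
    · linarith [h'.2 x hi]
  · right
    have e : x - (a - δ - a) = x + δ := by ring
    rw [e]
    obtain ⟨i, hi⟩ := h (x + δ) (by linarith) (by linarith)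
    refine ⟨⟨i, hmem i _ hi fun h' => by linarith [(hcx _ h').2]⟩, ?_, by linarith, hi⟩
    by_cases hr : MeetsRight a (m i)
    · exact .inl hr
    refine .inr ⟨?_, fun x' hx' => ?_⟩
    · rintro ⟨y, -, hy⟩
      have := (hm i).sub_le_sqrt_two hy hi
      linarith [(hcx _ hi₀).2]
    · by_contra hlt
      push Not at hlt
      have hmid : m i (a / 2) 0 := (hm i).convex hx' hi (by linarith) (by linarith [(hcx _ hi₀).2])
      have h3 := hmin i hmid
      have h4 := csInf_le (hbdd i) hx'
      linarith

lemma two_le_Sbd {n : ℕ} (hn : 4 ≤ n) : 2 ≤ Sbd n := by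
  refine le_Sbd (ι := Fin 4) (by omega) (by simpa) (m := fun i x y =>
    (0 ≤ x - ![0, 1, 0, 1] i ∧ x - ![0, 1, 0, 1] i ≤ 1) ∧
      (0 ≤ y - ![0, 0, 1, 1] i ∧ y - ![0, 0, 1, 1] i ≤ 1))
    (fun i => isUnitSq_unit.shift _ _) two_pos fun x y hxy => ?_
  have hx : 0 ≤ x ∧ x ≤ 2 := by
    rcases hxy with ⟨⟨h1, h2⟩, h | h⟩ | ⟨⟨h1, h2⟩, h | h⟩ <;> constructor <;> linarith
  have hy : 0 ≤ y ∧ y ≤ 2 := by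
    rcases hxy with ⟨⟨h1, h2⟩, h | h⟩ | ⟨⟨h1, h2⟩, h | h⟩ <;> constructor <;> linarith
  rcases le_total x 1 with h1 | h1 <;> rcases le_total y 1 with h2 | h2
  · exact ⟨0, by simp; tauto⟩
  · exact ⟨2, by simp; refine ⟨?_, ?_, ?_⟩ <;> first | tauto | linarith⟩
  · exact ⟨1, by simp; refine ⟨⟨?_, ?_⟩, ?_⟩ <;> first | tauto | linarith⟩
  · exact ⟨3, by simp; refine ⟨⟨?_, ?_⟩, ?_, ?_⟩ <;> linarith⟩

lemma Sbd_add_sqrt_two_le {n : ℕ} (hn : 4 ≤ n) : Sbd n + √2 ≤ Sbd (n + 4) := by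
  have h2 := two_le_Sbd hn
  obtain ⟨-, m, hm, hcov⟩ := mem_bdCoverableEdges.1 (isGreatest_Sbd (by omega : 0 < n)).1
  set a := Sbd n
  obtain ⟨s1, s2, s3, s4⟩ := hcov.sides
  obtain ⟨G₁, hG₁, b₁⟩ := exists_bottomSplit_expand hm h2 s1
  obtain ⟨G₂, hG₂, b₂⟩ := exists_bottomSplit_expand (fun i => (hm i).swap) h2 s2
  obtain ⟨G₃, hG₃, b₃⟩ := exists_bottomSplit_expand (fun i => (hm i).flip' a) h2
    (by simpa using s3)
  obtain ⟨G₄, hG₄, b₄⟩ := exists_bottomSplit_expand (fun i => ((hm i).flip a).swap) h2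
    (by simpa using s4)
  obtain ⟨d, e, hde⟩ := exists_translates hm (by linarith [sqrt_two_lt]) b₁ b₂ b₃ b₄
  refine le_Sbd (ι := Fin n ⊕ Fin 4) (by omega) (by simp)
    (m := Sum.elim (fun i x y => m i (x - d i) (y - e i))
      ![G₁, fun x y => G₂ y x, fun x y => G₃ x (a + √2 - y), fun x y => G₄ y (a + √2 - x)]) ?_
    (by positivity) fun x y hxy => ?_
  · rintro (i | i)
    · exact (hm i).shift _ _
    · fin_cases i
      exacts [hG₁, hG₂.swap, hG₃.flip' _, (hG₄.flip' _).swap]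
  · rcases hde x y hxy with ⟨i, h⟩ | h | h | h | h
    exacts [⟨.inl i, h⟩, ⟨.inr 0, h⟩, ⟨.inr 1, h⟩, ⟨.inr 2, h⟩, ⟨.inr 3, h⟩]

lemma Sbd_le_add_sqrt_two {n : ℕ} (hn : 4 ≤ n) : Sbd (n + 4) ≤ Sbd n + √2 := by
  -- The opposite inequality gives `b ≥ 2 + √2`, so half a side exceeds `√2`: a square covering the
  -- midpoint of one side meets no other side.
  have hb := (two_le_Sbd hn).trans (le_sub_iff_add_le.2 (Sbd_add_sqrt_two_le hn))
  obtain ⟨-, m, hm, hcov⟩ := mem_bdCoverableEdges.1 (isGreatest_Sbd (by omega : 0 < n + 4)).1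
  set b := Sbd (n + 4)
  have hs := lt_sqrt_two
  have hs' := sqrt_two_lt
  suffices h : ∀ δ, √2 < δ → δ ≤ 2 → b - δ ≤ Sbd n by
    refine le_of_forall_pos_le_add fun ε hε => ?_
    have := h (√2 + min ε (1 / 2)) (by simpa using hε) (by linarith [min_le_right ε (1 / 2)])
    linarith [min_le_left ε (1 / 2)]
  intro δ hδ hδ'
  have hb3 : 3 ≤ b := by linarith
  obtain ⟨s1, s2, s3, s4⟩ := hcov.sides
  obtain ⟨i₁, hi₁, b₁⟩ := exists_bottomSplit_shrink hm hb3 hδ hδ' s1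
  obtain ⟨i₂, hi₂, b₂⟩ := exists_bottomSplit_shrink (fun i => (hm i).swap) hb3 hδ hδ' s2
  obtain ⟨i₃, hi₃, b₃⟩ := exists_bottomSplit_shrink (fun i => (hm i).flip' b) hb3 hδ hδ'
    (by simpa using s3)
  obtain ⟨i₄, hi₄, b₄⟩ := exists_bottomSplit_shrink (fun i => ((hm i).flip b).swap) hb3 hδ hδ'
    (by simpa using s4)
  simp only [sub_zero] at hi₃ hi₄ b₃ b₄
  have far : ∀ i x y x' y', m i x y → m i x' y' → √2 < x' - x ∨ √2 < y' - y → False := by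
    rintro i x y x' y' h h' (h'' | h'')
    · linarith [(hm i).sub_le_sqrt_two h h']
    · linarith [(hm i).sub_le_sqrt_two' h h']
  have h12 : i₁ ≠ i₂ := by rintro rfl; exact far _ _ _ _ _ hi₂ hi₁ (.inl (by linarith))
  have h13 : i₁ ≠ i₃ := by rintro rfl; exact far _ _ _ _ _ hi₁ hi₃ (.inr (by linarith))
  have h14 : i₁ ≠ i₄ := by rintro rfl; exact far _ _ _ _ _ hi₁ hi₄ (.inr (by linarith))
  have h23 : i₂ ≠ i₃ := by rintro rfl; exact far _ _ _ _ _ hi₂ hi₃ (.inl (by linarith))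
  have h24 : i₂ ≠ i₄ := by rintro rfl; exact far _ _ _ _ _ hi₂ hi₄ (.inl (by linarith))
  have h34 : i₃ ≠ i₄ := by rintro rfl; exact far _ _ _ _ _ hi₃ hi₄ (.inl (by linarith))
  set s : Finset (Fin (n + 4)) := {i₁, i₂, i₃, i₄}ᶜ with hsdef
  have hcard : s.card = n := by
    rw [hsdef, Finset.card_compl, Finset.card_insert_of_notMem, Finset.card_insert_of_notMem,
      Finset.card_pair h34, Fintype.card_fin] <;> simp [*]
  have hnot : ∀ i ∉ s, i = i₁ ∨ i = i₂ ∨ i = i₃ ∨ i = i₄ := by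
    intro i hi
    simp only [hsdef, Finset.mem_compl, not_not, Finset.mem_insert, Finset.mem_singleton] at hi
    exact hi
  have c1 := b₁ s fun i hi => by
    rcases hnot i hi with rfl | rfl | rfl | rfl
    · exact .inl rfl
    · exact .inr fun x hx => far _ _ _ _ _ hx hi₂ (.inr (by linarith))
    · exact .inr fun x hx => far _ _ _ _ _ hx hi₃ (.inr (by linarith))
    · exact .inr fun x hx => far _ _ _ _ _ hx hi₄ (.inr (by linarith))
  have c2 := b₂ s fun i hi => by
    rcases hnot i hi with rfl | rfl | rfl | rfl
    · exact .inr fun x hx => far _ _ _ _ _ hx hi₁ (.inl (by linarith))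
    · exact .inl rfl
    · exact .inr fun x hx => far _ _ _ _ _ hx hi₃ (.inl (by linarith))
    · exact .inr fun x hx => far _ _ _ _ _ hx hi₄ (.inl (by linarith))
  have c3 := b₃ s fun i hi => by
    rcases hnot i hi with rfl | rfl | rfl | rfl
    · exact .inr fun x hx => far _ _ _ _ _ hi₁ hx (.inr (by linarith))
    · exact .inr fun x hx => far _ _ _ _ _ hi₂ hx (.inr (by linarith))
    · exact .inl rfl
    · exact .inr fun x hx => far _ _ _ _ _ hi₄ hx (.inr (by linarith))
  have c4 := b₄ s fun i hi => by
    rcases hnot i hi with rfl | rfl | rfl | rfl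
    · exact .inr fun x hx => far _ _ _ _ _ hi₁ hx (.inl (by linarith))
    · exact .inr fun x hx => far _ _ _ _ _ hi₂ hx (.inl (by linarith))
    · exact .inr fun x hx => far _ _ _ _ _ hi₃ hx (.inl (by linarith))
    · exact .inl rfl
  obtain ⟨d, e, hde⟩ := exists_translates (fun i : s => hm i) (by linarith) c1 c2
    (by simpa using c3) (by simpa using c4)
  refine le_Sbd (ι := s) (by omega) (by simp [hcard])
    (m := fun i x y => m i (x - d i) (y - e i)) (fun i => (hm i).shift _ _) (by linarith)
    fun x y hxy => ?_
  simpa using hde x y hxy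

/-! ### Four unit squares. -/

/-- Different vertices of `[0, a]²` are covered by different unit squares. -/
lemma CoversBd.exists_corners {ι : Type*} {m : ι → ℝ → ℝ → Prop} {a : ℝ} (h : CoversBd m a)
    (hm : ∀ i, IsUnitSq (m i)) (ha : √2 < a) : ∃ f : Fin 4 → ι, Function.Injective f ∧
      m (f 0) 0 0 ∧ m (f 1) a 0 ∧ m (f 2) 0 a ∧ m (f 3) a a := by
  have ha0 : 0 ≤ a := (Real.sqrt_nonneg 2).trans ha.le
  obtain ⟨s1, s2, s3, s4⟩ := h.sides
  obtain ⟨i₀, h0⟩ := s1 0 le_rfl ha0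
  obtain ⟨i₁, h1⟩ := s1 a ha0 le_rfl
  obtain ⟨i₂, h2⟩ := s2 a ha0 le_rfl
  obtain ⟨i₃, h3⟩ := s3 a ha0 le_rfl
  have n01 : i₀ ≠ i₁ := by rintro rfl; exact (hm _).not_opposite' ha h0 h1
  have n02 : i₀ ≠ i₂ := by rintro rfl; exact (hm _).not_opposite ha h0 h2
  have n03 : i₀ ≠ i₃ := by rintro rfl; exact (hm _).not_opposite ha h0 h3
  have n12 : i₁ ≠ i₂ := by rintro rfl; exact (hm _).not_opposite ha h1 h2
  have n13 : i₁ ≠ i₃ := by rintro rfl; exact (hm _).not_opposite ha h1 h3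
  have n23 : i₂ ≠ i₃ := by rintro rfl; exact (hm _).not_opposite' ha h2 h3
  refine ⟨![i₀, i₁, i₂, i₃], ?_, h0, h1, h2, h3⟩
  intro i j hij
  fin_cases i <;> fin_cases j <;> simp_all

lemma IsUnitSq.eq_of_leg_one {m : ℝ → ℝ → Prop} (h : IsUnitSq m) (h0 : m 0 0) (h1 : m 1 0)
    (h2 : m 0 1) (x y : ℝ) : m x y ↔ (0 ≤ x ∧ x ≤ 1) ∧ (0 ≤ y ∧ y ≤ 1) := by
  have := h.eq_of_leg_eq le_rfl zero_le_one le_rfl (by norm_num) (by norm_num) h0 h1 h2 x y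
  simpa using this

/-- By connectedness neighbouring squares share a point of their side: `p`, `q`, `t`, `r` on the
bottom, left, top and right. The two legs at each vertex have sum at most 2, and all eight legs add
up to `4a ≥ 8`, so equality holds throughout. -/
lemma covers_two_of_four {m : Fin 4 → ℝ → ℝ → Prop} {a : ℝ} (ha : 2 ≤ a)
    (hm : ∀ i, IsUnitSq (m i)) (h : CoversBd m a) (h0 : m 0 0 0) (h1 : m 1 a 0) (h2 : m 2 0 a)
    (h3 : m 3 a a) : a = 2 ∧ ∀ i x y, m i x y ↔
      (0 ≤ x - ![0, 1, 0, 1] i ∧ x - ![0, 1, 0, 1] i ≤ 1) ∧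
      (0 ≤ y - ![0, 0, 1, 1] i ∧ y - ![0, 0, 1, 1] i ≤ 1) := by
  have ha2 : √2 < a := by linarith [sqrt_two_lt]
  have ha0 : 0 ≤ a := by linarith
  obtain ⟨s1, s2, s3, s4⟩ := h.sides
  have opp : ∀ i {x x'}, m i x 0 → m i x' a → False := fun i _ _ => (hm i).not_opposite ha2
  have opp' : ∀ i {y y'}, m i 0 y → m i a y' → False := fun i _ _ => (hm i).not_opposite' ha2
  obtain ⟨p, ⟨p0, p1⟩, hp, hp'⟩ := exists_mem_both ((hm 0).isClosed 0) ((hm 1).isClosed 0) ha0 h0 h1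
    fun x hx0 hx1 => by
      obtain ⟨i, hi⟩ := s1 x hx0 hx1
      fin_cases i
      exacts [.inl hi, .inr hi, (opp _ hi h2).elim, (opp _ hi h3).elim]
  obtain ⟨q, ⟨q0, q1⟩, hq, hq'⟩ := exists_mem_both ((hm 0).swap.isClosed 0)
    ((hm 2).swap.isClosed 0) ha0 h0 h2 fun x hx0 hx1 => by
      obtain ⟨i, hi⟩ := s2 x hx0 hx1
      fin_cases i
      exacts [.inl hi, (opp' _ hi h1).elim, .inr hi, (opp' _ hi h3).elim]
  obtain ⟨t, ⟨t0, t1⟩, ht, ht'⟩ := exists_mem_both ((hm 2).isClosed a) ((hm 3).isClosed a) ha0 h2 h3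
    fun x hx0 hx1 => by
      obtain ⟨i, hi⟩ := s3 x hx0 hx1
      fin_cases i
      exacts [(opp _ h0 hi).elim, (opp _ h1 hi).elim, .inl hi, .inr hi]
  obtain ⟨r, ⟨r0, r1⟩, hr, hr'⟩ := exists_mem_both ((hm 1).swap.isClosed a)
    ((hm 3).swap.isClosed a) ha0 h1 h3 fun x hx0 hx1 => by
      obtain ⟨i, hi⟩ := s4 x hx0 hx1
      fin_cases i
      exacts [(opp' _ h0 hi).elim, .inl hi, (opp' _ h2 hi).elim, .inr hi]
  have d0 := (hm 0).sq_add_sq_le hp hq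
  have d1 := (hm 1).sq_add_sq_le hp' hr
  have d2 := (hm 2).sq_add_sq_le hq' ht
  have d3 := (hm 3).sq_add_sq_le ht' hr'
  have sum_le : ∀ {u v : ℝ}, u ^ 2 + v ^ 2 ≤ 2 → u + v ≤ 2 := fun {u v} h => by
    nlinarith [sq_nonneg (u - 1), sq_nonneg (v - 1)]
  have eq_one : ∀ {u v : ℝ}, u ^ 2 + v ^ 2 ≤ 2 → u + v = 2 → u = 1 := fun {u v} h h' => by
    obtain rfl : v = 2 - u := by linarith
    have : (u - 1) ^ 2 = 0 := le_antisymm (by linarith) (sq_nonneg _)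
    linarith [pow_eq_zero_iff two_ne_zero |>.1 this]
  have c0 : p ^ 2 + q ^ 2 ≤ 2 := by linarith
  have c1 : (a - p) ^ 2 + r ^ 2 ≤ 2 := by linarith
  have c2 : (a - q) ^ 2 + t ^ 2 ≤ 2 := by linarith
  have c3 : (a - r) ^ 2 + (a - t) ^ 2 ≤ 2 := by linarith
  have l0 := sum_le c0
  have l1 := sum_le c1
  have l2 := sum_le c2
  have l3 := sum_le c3
  obtain rfl : a = 2 := by linarith
  have ep : p = 1 := eq_one c0 (by linarith)
  have eq : q = 1 := by linarith
  have et : t = 1 := by linarith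
  have er : r = 1 := by linarith
  subst ep eq et er
  have e : (2 : ℝ) - 1 = 1 := by norm_num
  refine ⟨rfl, fun i x y => ?_⟩
  fin_cases i
  · have := (hm 0).eq_of_leg_one h0 hp hq x y
    simpa using this
  · have := ((hm 1).flip 2).eq_of_leg_one (by simpa) (by simpa [e]) (by simpa) (2 - x) y
    simp only [sub_sub_cancel] at this
    refine this.trans ?_
    change _ ↔ (0 ≤ x - 1 ∧ x - 1 ≤ 1) ∧ (0 ≤ y - 0 ∧ y - 0 ≤ 1)
    constructor <;> rintro ⟨⟨_, _⟩, _, _⟩ <;> refine ⟨⟨?_, ?_⟩, ?_, ?_⟩ <;> linarith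
  · have := ((hm 2).flip' 2).eq_of_leg_one (by simpa) (by simpa) (by simpa [e]) x (2 - y)
    simp only [sub_sub_cancel] at this
    refine this.trans ?_
    change _ ↔ (0 ≤ x - 0 ∧ x - 0 ≤ 1) ∧ (0 ≤ y - 1 ∧ y - 1 ≤ 1)
    constructor <;> rintro ⟨⟨_, _⟩, _, _⟩ <;> refine ⟨⟨?_, ?_⟩, ?_, ?_⟩ <;> linarith
  · have := (((hm 3).flip' 2).flip 2).eq_of_leg_one (by simpa) (by simpa [e]) (by simpa [e])
      (2 - x) (2 - y)
    simp only [sub_sub_cancel] at this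
    refine this.trans ?_
    change _ ↔ (0 ≤ x - 1 ∧ x - 1 ≤ 1) ∧ (0 ≤ y - 1 ∧ y - 1 ≤ 1)
    constructor <;> rintro ⟨⟨_, _⟩, _, _⟩ <;> refine ⟨⟨?_, ?_⟩, ?_, ?_⟩ <;> linarith

/-- Four unit squares that cover the boundary of `[0, a]²` with `a ≥ 2` are its quarters. -/
lemma CoversBd.quarters {m : Fin 4 → ℝ → ℝ → Prop} {a : ℝ} (h : CoversBd m a) (ha : 2 ≤ a)
    (hm : ∀ i, IsUnitSq (m i)) : a = 2 ∧ ∀ i, ∃ j k : ℝ, (∀ x y, m i x y ↔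
      (0 ≤ x - j ∧ x - j ≤ 1) ∧ (0 ≤ y - k ∧ y - k ≤ 1)) := by
  obtain ⟨f, hf, h0, h1, h2, h3⟩ := h.exists_corners hm (by linarith [sqrt_two_lt])
  have hfs : Function.Surjective f := Finite.injective_iff_surjective.1 hf
  obtain ⟨e, he⟩ := covers_two_of_four (m := fun i => m (f i)) ha (fun i => hm _) (fun x y hxy => by
    obtain ⟨i, hi⟩ := h x y hxy
    obtain ⟨j, rfl⟩ := hfs i
    exact ⟨j, hi⟩) h0 h1 h2 h3
  refine ⟨e, fun i => ?_⟩
  obtain ⟨j, rfl⟩ := hfs i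
  exact ⟨_, _, he j⟩

lemma Sbd_four : Sbd 4 = 2 := by
  obtain ⟨-, m, hm, h⟩ := mem_bdCoverableEdges.1 (isGreatest_Sbd (n := 4) (by norm_num)).1
  exact (h.quarters (two_le_Sbd le_rfl) hm).1

/-- The squares `[j, j + 1] × [k, k + 1]` are homothetic to `[0, 2]²`, in any position. -/
lemma isHomotheticTo_image_box {T : Set Plane} (φ : Plane ≃ᵢ Plane) {j k : ℝ}
    (h : ∀ x y, φ (pt x y) ∈ T ↔ (0 ≤ x - j ∧ x - j ≤ 1) ∧ (0 ≤ y - k ∧ y - k ≤ 1)) :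
    IsHomotheticTo T (φ '' box 2) := by
  set L := φ.toRealAffineIsometryEquiv
  -- The centre `(2j, 2k)` is the fixed point of `z ↦ (j, k) + z / 2`.
  have key : ∀ x y, AffineMap.homothety (φ (pt (2 * j) (2 * k))) (1 / 2 : ℝ) (φ (pt x y)) =
      φ (pt (j + x / 2) (k + y / 2)) := by
    intro x y
    have h1 := L.toAffineEquiv.toAffineMap.apply_lineMap (pt (2 * j) (2 * k)) (pt x y) (1 / 2 : ℝ)
    rw [AffineMap.homothety_eq_lineMap]
    refine (h1.symm).trans ?_
    change φ _ = φ _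
    congr 1
    apply plane_ext <;> simp [AffineMap.lineMap_apply] <;> ring
  refine ⟨φ (pt (2 * j) (2 * k)), 1 / 2, by norm_num, ?_⟩
  ext z
  constructor
  · intro hz
    obtain ⟨w, rfl⟩ := φ.surjective z
    rw [← pt_eta w, h] at hz
    refine ⟨φ (pt (2 * (w 0 - j)) (2 * (w 1 - k))), ⟨_, mem_box.2 ?_, rfl⟩, ?_⟩
    · simp only [pt_zero, pt_one]
      refine ⟨⟨?_, ?_⟩, ?_, ?_⟩ <;> linarith [hz.1.1, hz.1.2, hz.2.1, hz.2.2]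
    · rw [key]
      congr 1
      apply plane_ext <;> simp
  · rintro ⟨_, ⟨w, hw, rfl⟩, rfl⟩
    rw [mem_box] at hw
    rw [← pt_eta w, key, h]
    refine ⟨⟨?_, ?_⟩, ?_, ?_⟩ <;> linarith [hw.1.1, hw.1.2, hw.2.1, hw.2.2]

theorem isHomotheticTo_of_cover {Q : Set Plane} {F : Fin 4 → Set Plane} (hQ : IsSquareOfEdge 2 Q)
    (hF : IsUnitSquareCover F (frontier Q)) (i : Fin 4) : IsHomotheticTo (F i) Q := by
  obtain ⟨φ, rfl⟩ := hQ.exists_image_box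
  obtain ⟨hm, h⟩ := coversBd_of_cover two_pos rfl hF
  obtain ⟨j, k, hjk⟩ := (h.quarters le_rfl hm).2 i
  exact isHomotheticTo_image_box φ hjk

/-! ### The number `x̄` and linear estimates of `leg`. -/

lemma xbar_sq : xbar ^ 2 = (√(13 - 8 * √2) + 1) / 2 := by
  have h1 : (√2) ^ 2 = 2 := Real.sq_sqrt (by norm_num)
  have h2 : (√(√(13 - 8 * √2) + 1)) ^ 2 = √(13 - 8 * √2) + 1 := Real.sq_sqrt (by positivity)
  rw [xbar, mul_pow, mul_pow, h1, h2]
  ring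

lemma xbar_nonneg : 0 ≤ xbar := by
  unfold xbar; positivity

lemma sqrt_two_bounds : 1.41421 < √2 ∧ √2 < 1.41422 := by
  constructor
  · rw [Real.lt_sqrt (by norm_num)]; norm_num
  · rw [Real.sqrt_lt' (by norm_num)]; norm_num

lemma xbar_bounds : 1.0717 < xbar ∧ xbar < 1.0723 := by
  obtain ⟨h1, h2⟩ := sqrt_two_bounds
  have h3 : 1.2981 < √(13 - 8 * √2) := by
    rw [Real.lt_sqrt (by norm_num)]; norm_num; linarith
  have h4 : √(13 - 8 * √2) < 1.2992 := by
    rw [Real.sqrt_lt' (by norm_num)]; norm_num; linarith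
  constructor
  · refine lt_of_pow_lt_pow_left₀ 2 xbar_nonneg ?_
    rw [xbar_sq]; norm_num; linarith
  · refine lt_of_pow_lt_pow_left₀ 2 (by norm_num) ?_
    rw [xbar_sq]; norm_num; linarith

lemma wbar_nonneg : 0 ≤ wbar := Real.sqrt_nonneg _

lemma wbar_sq : wbar ^ 2 = xbar ^ 2 - 1 :=
  Real.sq_sqrt (by nlinarith [xbar_bounds.1])

/-- This is the defining equation of `x̄`: squared, it is quadratic in `x̄²` with discriminant `13 -
8√2`. It says that `leg x̄` and a diagonal together fill a side of length `x̄ + 1`. -/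
lemma xbar_mul_wbar : xbar * wbar = √2 - 1 := by
  have h1 : (√2) ^ 2 = 2 := Real.sq_sqrt (by norm_num)
  have h0 := sqrt_two_bounds.2
  have h2 : (√(13 - 8 * √2)) ^ 2 = 13 - 8 * √2 := Real.sq_sqrt (by linarith)
  have h3 : (xbar * wbar) ^ 2 = (√2 - 1) ^ 2 := by
    rw [mul_pow, wbar_sq, xbar_sq]
    linear_combination h2 / 4 - h1
  exact (pow_left_inj₀ (mul_nonneg xbar_nonneg wbar_nonneg) (by linarith [sqrt_two_bounds.1])
    two_ne_zero).1 h3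

lemma wbar_le_one : wbar ≤ 1 := by
  have := wbar_sq
  nlinarith [xbar_bounds.2, xbar_bounds.1, wbar_nonneg]

lemma leg_xbar : xbar + 1 - √2 = xbar - xbar * wbar := by
  rw [xbar_mul_wbar]; ring

/-- Squaring removes the root, so each linear estimate of `leg` below becomes a polynomial
inequality. -/
lemma leg_le_of_sq_le {x b : ℝ} (hx : 0 ≤ x) (h : b ^ 2 ≤ x ^ 2 * (x ^ 2 - 1)) :
    leg x ≤ x - b := by
  have e : x * √(x ^ 2 - 1) = √(x ^ 2 * (x ^ 2 - 1)) := by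
    rw [Real.sqrt_mul (by positivity), Real.sqrt_sq hx]
  rw [leg, e]
  linarith [Real.le_sqrt_of_sq_le h]

lemma xbar_quartic : xbar ^ 2 * (xbar ^ 2 - 1) = (√2 - 1) ^ 2 := by
  rw [← wbar_sq, ← mul_pow, xbar_mul_wbar]

/-- The slopes in this and the next three estimates are rounded so that `4.5 * 1.6 > 3.5 * 2`, which
is what `legs_eq` needs. -/
lemma leg_le_near_one {x : ℝ} (h1 : 1 ≤ x) (h2 : x ≤ xbar) : leg x ≤ 1 - 4.5 * (x - 1) := by
  have hx := xbar_bounds.2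
  have := leg_le_of_sq_le (x := x) (b := 5.5 * (x - 1)) (by linarith) (by
    have : 0 ≤ (x - 1) * (x ^ 2 * (x + 1) - 30.25 * (x - 1)) :=
      mul_nonneg (by linarith) (by nlinarith)
    nlinarith)
  linarith

lemma leg_le_below_xbar {x : ℝ} (h1 : 1.035 ≤ x) (h2 : x ≤ xbar) :
    leg x ≤ xbar + 1 - √2 + 3.5 * (xbar - x) := by
  obtain ⟨b1, b2⟩ := xbar_bounds
  obtain ⟨r1, r2⟩ := sqrt_two_bounds
  have h3 : (xbar + x) * (xbar ^ 2 + x ^ 2 - 1) ≤ 2.1446 * 1.2997 :=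
    mul_le_mul (by linarith) (by nlinarith) (by nlinarith) (by norm_num)
  have h4 := mul_le_mul_of_nonneg_left h3 (sub_nonneg.2 h2)
  have := leg_le_of_sq_le (x := x) (b := √2 - 1 - 4.5 * (xbar - x)) (by linarith) (by
    have e : x ^ 2 * (x ^ 2 - 1) = (√2 - 1) ^ 2 -
      (xbar - x) * ((xbar + x) * (xbar ^ 2 + x ^ 2 - 1)) := by rw [← xbar_quartic]; ring
    rw [e]
    have h5 : 0 ≤ (xbar - x) * (9 * (√2 - 1) - 20.25 * (xbar - x) - 2.1446 * 1.2997) :=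
      mul_nonneg (by linarith) (by linarith)
    nlinarith)
  linarith

lemma leg_le_above_xbar {x : ℝ} (h1 : xbar ≤ x) (h2 : x ≤ √2) :
    leg x ≤ xbar + 1 - √2 - 1.6 * (x - xbar) := by
  obtain ⟨b1, b2⟩ := xbar_bounds
  obtain ⟨r1, r2⟩ := sqrt_two_bounds
  have h0 : 0 ≤ x - xbar := by linarith
  have h3 : 5.2 * (√2 - 1) + 6.76 * (x - xbar) ≤ (x + xbar) * (xbar ^ 2 + x ^ 2 - 1) := by
    have e : (x + xbar) * (xbar ^ 2 + x ^ 2 - 1) = 2 * xbar * (2 * xbar ^ 2 - 1) +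
      (x - xbar) * (6 * xbar ^ 2 - 1) + (x - xbar) ^ 2 * (4 * xbar + (x - xbar)) := by ring
    have h4 : 0 ≤ (x - xbar) ^ 2 * (4 * xbar + (x - xbar)) := by positivity
    have h5 : (x - xbar) * 5.8 ≤ (x - xbar) * (6 * xbar ^ 2 - 1) :=
      mul_le_mul_of_nonneg_left (by nlinarith) h0
    have h6 : 2.14 * 1.29 ≤ 2 * xbar * (2 * xbar ^ 2 - 1) :=
      mul_le_mul (by linarith) (by nlinarith) (by norm_num) (by linarith)
    rw [e]
    linarith
  have h4 := mul_le_mul_of_nonneg_left h3 h0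
  have := leg_le_of_sq_le (x := x) (b := √2 - 1 + 2.6 * (x - xbar)) (by linarith) (by
    have e : x ^ 2 * (x ^ 2 - 1) = (√2 - 1) ^ 2 +
      (x - xbar) * ((x + xbar) * (xbar ^ 2 + x ^ 2 - 1)) := by rw [← xbar_quartic]; ring
    rw [e]
    nlinarith)
  linarith

/-- The right-hand side is the tangent of `leg` at its zero `√2`, hence the factor `(x - √2)²` in
the comparison. -/
lemma leg_le_near_sqrt_two {x : ℝ} (h1 : xbar ≤ x) : leg x ≤ 2 * (√2 - x) := by
  obtain ⟨b1, b2⟩ := xbar_bounds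
  obtain ⟨r1, r2⟩ := sqrt_two_bounds
  have hs : (√2) ^ 2 = 2 := Real.sq_sqrt (by norm_num)
  have := leg_le_of_sq_le (x := x) (b := 3 * x - 2 * √2) (by linarith) (by
    have h3 : 0 ≤ (x - √2) ^ 2 * (x ^ 2 + 2 * √2 * x - 4) :=
      mul_nonneg (sq_nonneg _) (by nlinarith)
    have e : (x - √2) ^ 2 * (x ^ 2 + 2 * √2 * x - 4) =
        x ^ 2 * (x ^ 2 - 1) - (3 * x - 2 * √2) ^ 2 := by
      linear_combination (2 * √2 * x - 3 * x ^ 2) * hs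
    linarith)
  linarith

/-- The legs of the four corner squares of an optimal configuration. -/
lemma legs_eq {a p q t y y' : ℝ} (ha : xbar + 1 ≤ a) (hqa : q ≤ a - q)
    (hO : 1 ≤ q → p ≤ leg q)
    (hB : 1 ≤ a - p → y ≤ leg (a - p)) (hA : 1 ≤ a - q → t ≤ leg (a - q))
    (hD : 1 ≤ a - t → a - y' ≤ leg (a - t)) (hp : a - p ≤ √2) (ht : a - t ≤ √2)
    (hq : a - q ≤ √2) (hyy : y' - y ≤ √2) (hy' : y' ≤ a) :
    a = xbar + 1 ∧ p = 1 ∧ q = 1 ∧ t = xbar + 1 - √2 ∧ y = xbar + 1 - √2 ∧ y' = xbar + 1 := by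
  obtain ⟨b1, b2⟩ := xbar_bounds
  obtain ⟨r1, r2⟩ := sqrt_two_bounds
  have hA' := hA (by linarith)
  -- Otherwise `t < x̄ + 1 - √2`, which would leave `a - t > √2` to the square at `(a, a)`.
  have hqx : a - q ≤ xbar := by
    by_contra hlt
    have := leg_le_above_xbar (not_le.1 hlt).le hq
    linarith
  have hO' := (hO (by linarith)).trans (leg_le_near_one (by linarith) (by linarith))
  have hA'' := hA'.trans (leg_le_below_xbar (by linarith) hqx)
  have hB' := (hB (by linarith)).trans (leg_le_above_xbar (by linarith) hp)
  have hD' := (hD (by linarith)).trans (leg_le_near_sqrt_two (by linarith))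
  -- With `d = a - x̄ - 1 ≥ 0` and `e = q - 1 ≥ 0`, the chain gives `y ≤ x̄ + 1 - √2 - 1.6 d - 7.2
  -- e` and `a - y' ≤ 7 e - 9 d`. Together with `y' - y ≤ √2` this becomes `11.6 d + 0.2 e ≤ 0`.
  have e1 : a = xbar + 1 := by linarith
  have e2 : q = 1 := by linarith
  refine ⟨e1, ?_, e2, ?_, ?_, ?_⟩ <;> linarith

/-! ### The optimal configuration covers the boundary. -/

/-- Two unit squares that fit tightly around the same right angle are equal. -/
lemma IsUnitSq.iff_of_legs {m m' : ℝ → ℝ → Prop} (h : IsUnitSq m) (h' : IsUnitSq m') {x y w : ℝ}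
    (hx : 1 ≤ x) (hy : 0 ≤ y) (hw : 0 ≤ w) (hxw : w ^ 2 = x ^ 2 - 1) (hyx : y = x - x * w)
    (h0 : m 0 0) (h1 : m x 0) (h2 : m 0 y) (h0' : m' 0 0) (h1' : m' x 0) (h2' : m' 0 y)
    (x' y' : ℝ) : m x' y' ↔ m' x' y' :=
  (h.eq_of_leg_eq hx hy hw hxw hyx h0 h1 h2 x' y').trans
    (h'.eq_of_leg_eq hx hy hw hxw hyx h0' h1' h2' x' y').symm

/-- A unit square is determined by a diagonal. -/
lemma IsUnitSq.iff_of_diagonal {m m' : ℝ → ℝ → Prop} (h : IsUnitSq m) (h' : IsUnitSq m')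
    (h0 : m 0 0) (h1 : m (√2) 0) (h0' : m' 0 0) (h1' : m' (√2) 0) (x' y' : ℝ) :
    m x' y' ↔ m' x' y' :=
  h.iff_of_legs h' (x := √2) (y := 0) (w := 1) (by linarith [sqrt_two_bounds.1]) le_rfl zero_le_one
    (by rw [Real.sq_sqrt (by norm_num)]; norm_num) (by ring) h0 h1 h0 h0' h1' h0' x' y'

lemma isSquareOfEdge_squareAt {p u v : Plane} (hu : u 0 ^ 2 + u 1 ^ 2 = 1)
    (hv : v 0 ^ 2 + v 1 ^ 2 = 1) (huv : u 0 * v 0 + u 1 * v 1 = 0) :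
    IsSquareOfEdge 1 (squareAt p u v 1) :=
  ⟨one_pos, p, u, v, norm_plane_eq_one.2 hu, norm_plane_eq_one.2 hv,
    (inner_plane _ _).trans huv, rfl⟩

lemma xbar_pos : 0 < xbar := by linarith [xbar_bounds.1]

lemma opt_direction : (wbar / xbar) ^ 2 + (1 / xbar) ^ 2 = 1 := by
  have := xbar_pos
  field_simp
  linarith [wbar_sq]

lemma diag_direction : (√2 / 2) ^ 2 + (√2 / 2) ^ 2 = 1 := by
  have h1 : (√2) ^ 2 = 2 := Real.sq_sqrt (by norm_num)
  linear_combination h1 / 2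

lemma isSquareOfEdge_opt (i : Fin 5) : IsSquareOfEdge 1 (optUnitSquare i) := by
  have h1 := opt_direction
  have h2 := diag_direction
  simp only [one_div, inv_pow] at h1
  fin_cases i
  all_goals refine isSquareOfEdge_squareAt ?_ ?_ ?_ <;> simp <;> linarith

lemma isUnitSq_opt (i : Fin 5) : IsUnitSq fun x y => pt x y ∈ optUnitSquare i :=
  (isSquareOfEdge_opt i).isUnitSq

lemma pt_mem_squareAt {p u v : Plane} {x y : ℝ} (s t : ℝ) (hs0 : 0 ≤ s) (hs1 : s ≤ 1) (ht0 : 0 ≤ t)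
    (ht1 : t ≤ 1) (hx : x = p 0 + s * u 0 + t * v 0) (hy : y = p 1 + s * u 1 + t * v 1) :
    pt x y ∈ squareAt p u v 1 :=
  ⟨s, ⟨hs0, hs1⟩, t, ⟨ht0, ht1⟩, plane_ext (by simpa using hx) (by simpa using hy)⟩

lemma mem_opt_zero :
    pt 0 0 ∈ optUnitSquare 0 ∧ pt 1 0 ∈ optUnitSquare 0 ∧ pt 0 1 ∈ optUnitSquare 0 := by
  refine ⟨pt_mem_squareAt 0 0 ?_ ?_ ?_ ?_ ?_ ?_, pt_mem_squareAt 1 0 ?_ ?_ ?_ ?_ ?_ ?_,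
    pt_mem_squareAt 0 1 ?_ ?_ ?_ ?_ ?_ ?_⟩ <;> simp

lemma mem_opt_one : pt 1 0 ∈ optUnitSquare 1 ∧ pt (xbar + 1) 0 ∈ optUnitSquare 1 ∧
    pt (xbar + 1) (xbar + 1 - √2) ∈ optUnitSquare 1 := by
  have hx := xbar_pos
  have h1 := wbar_sq
  have h2 := xbar_mul_wbar
  have h3 := wbar_nonneg
  have h4 := wbar_le_one
  have h5 : 0 ≤ wbar * (1 - wbar) := mul_nonneg h3 (by linarith)
  have h6 : wbar * (1 - wbar) ≤ 1 := by nlinarith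
  refine ⟨pt_mem_squareAt 0 0 (by norm_num) (by norm_num) (by norm_num) (by norm_num) ?_ ?_,
    pt_mem_squareAt wbar 1 h3 h4 (by norm_num) (by norm_num) ?_ ?_,
    pt_mem_squareAt 1 (1 - wbar * (1 - wbar)) (by norm_num) (by norm_num) (by linarith)
      (by linarith) ?_ ?_⟩ <;> simp
  · field_simp; linarith
  · field_simp; ring
  · field_simp; linarith
  · rw [leg_xbar]; field_simp
    linear_combination (wbar - 1) * h1

lemma mem_opt_two : pt 0 1 ∈ optUnitSquare 2 ∧ pt 0 (xbar + 1) ∈ optUnitSquare 2 ∧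
    pt (xbar + 1 - √2) (xbar + 1) ∈ optUnitSquare 2 := by
  have hx := xbar_pos
  have h1 := wbar_sq
  have h2 := xbar_mul_wbar
  have h3 := wbar_nonneg
  have h4 := wbar_le_one
  have h5 : 0 ≤ wbar * (1 - wbar) := mul_nonneg h3 (by linarith)
  have h6 : wbar * (1 - wbar) ≤ 1 := by nlinarith
  refine ⟨pt_mem_squareAt 0 0 (by norm_num) (by norm_num) (by norm_num) (by norm_num) ?_ ?_,
    pt_mem_squareAt wbar 1 h3 h4 (by norm_num) (by norm_num) ?_ ?_,
    pt_mem_squareAt 1 (1 - wbar * (1 - wbar)) (by norm_num) (by norm_num) (by linarith)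
      (by linarith) ?_ ?_⟩ <;> simp
  · field_simp; ring
  · field_simp; linarith
  · rw [leg_xbar]; field_simp
    linear_combination (wbar - 1) * h1
  · field_simp; linarith

lemma mem_opt_three : pt (xbar + 1) (xbar + 1 - √2) ∈ optUnitSquare 3 ∧
    pt (xbar + 1) (xbar + 1) ∈ optUnitSquare 3 := by
  have h1 : (√2) ^ 2 = 2 := Real.sq_sqrt (by norm_num)
  refine ⟨pt_mem_squareAt 0 0 ?_ ?_ ?_ ?_ ?_ ?_, pt_mem_squareAt 1 1 ?_ ?_ ?_ ?_ ?_ ?_⟩ <;>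
    simp
  ring

lemma mem_opt_four : pt (xbar + 1 - √2) (xbar + 1) ∈ optUnitSquare 4 ∧
    pt (xbar + 1) (xbar + 1) ∈ optUnitSquare 4 := by
  have h1 : (√2) ^ 2 = 2 := Real.sq_sqrt (by norm_num)
  refine ⟨pt_mem_squareAt 0 0 ?_ ?_ ?_ ?_ ?_ ?_, pt_mem_squareAt 1 1 ?_ ?_ ?_ ?_ ?_ ?_⟩ <;>
    simp
  ring

lemma coversBd_opt : CoversBd (fun i x y => pt x y ∈ optUnitSquare i) (xbar + 1) := by
  obtain ⟨b1, b2⟩ := xbar_bounds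
  obtain ⟨z1, z2, z3⟩ := mem_opt_zero
  obtain ⟨o1, o2, o3⟩ := mem_opt_one
  obtain ⟨t1, t2, t3⟩ := mem_opt_two
  obtain ⟨r1, r2⟩ := mem_opt_three
  obtain ⟨f1, f2⟩ := mem_opt_four
  rintro x y (⟨⟨h1, h2⟩, rfl | rfl⟩ | ⟨⟨h1, h2⟩, rfl | rfl⟩)
  · rcases le_total x 1 with h | h
    exacts [⟨0, (isUnitSq_opt 0).convex z1 z2 h1 h⟩, ⟨1, (isUnitSq_opt 1).convex o1 o2 h h2⟩]
  · rcases le_total x (xbar + 1 - √2) with h | h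
    exacts [⟨2, (isUnitSq_opt 2).convex t2 t3 h1 h⟩, ⟨4, (isUnitSq_opt 4).convex f1 f2 h h2⟩]
  · rcases le_total y 1 with h | h
    exacts [⟨0, (isUnitSq_opt 0).swap.convex z1 z3 h1 h⟩,
      ⟨2, (isUnitSq_opt 2).swap.convex t1 t2 h h2⟩]
  · rcases le_total y (xbar + 1 - √2) with h | h
    exacts [⟨1, (isUnitSq_opt 1).swap.convex o2 o3 h1 h⟩,
      ⟨3, (isUnitSq_opt 3).swap.convex r1 r2 h h2⟩]

lemma xbar_add_one_le_Sbd : xbar + 1 ≤ Sbd 5 :=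
  le_Sbd (by norm_num) (by simp) isUnitSq_opt (by linarith [xbar_pos]) coversBd_opt

/-! ### Optimality under relabelling and symmetries of the square. -/

/-- The square `[0, a]²` and the five regions form an optimal configuration. -/
def IsOptimal (a : ℝ) (m : Fin 5 → ℝ → ℝ → Prop) : Prop :=
  a = xbar + 1 ∧ IsOptimalConfiguration (box a) fun i => {z | m i (z 0) (z 1)}

lemma IsOptimalConfiguration.image {Q : Set Plane} {F : Fin 5 → Set Plane}
    (h : IsOptimalConfiguration Q F) (ψ : Plane ≃ᵢ Plane) :
    IsOptimalConfiguration (ψ '' Q) fun i => ψ '' F i := by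
  obtain ⟨φ, σ, rfl, h⟩ := h
  exact ⟨φ.trans ψ, σ, image_image _ _ _, fun i =>
    (congrArg (ψ '' ·) (h i)).trans (image_image _ _ _)⟩

lemma IsOptimal.of_perm {a : ℝ} {m : Fin 5 → ℝ → ℝ → Prop} (σ : Equiv.Perm (Fin 5))
    (h : IsOptimal a fun i => m (σ i)) : IsOptimal a m := by
  obtain ⟨e, φ, τ, hQ, h⟩ := h
  exact ⟨e, φ, σ.symm.trans τ, hQ, fun i => by simpa using h (σ.symm i)⟩

lemma IsOptimal.of_isometry {a : ℝ} {m : Fin 5 → ℝ → ℝ → Prop} (ψ : Plane ≃ᵢ Plane)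
    (hψ : ∀ z, ψ z ∈ box a ↔ z ∈ box a)
    (h : IsOptimal a fun i x y => m i (ψ (pt x y) 0) (ψ (pt x y) 1)) : IsOptimal a m := by
  refine ⟨h.1, ?_⟩
  have := h.2.image ψ
  have e1 : ψ '' box a = box a := by
    ext z
    obtain ⟨w, rfl⟩ := ψ.surjective z
    rw [ψ.injective.mem_set_image, hψ]
  have e2 : ∀ i, ψ '' {z | m i (ψ (pt (z 0) (z 1)) 0) (ψ (pt (z 0) (z 1)) 1)} =
      {z | m i (z 0) (z 1)} := by
    intro i
    ext z
    obtain ⟨w, rfl⟩ := ψ.surjective z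
    rw [ψ.injective.mem_set_image]
    simp
  simpa only [e1, e2] using this

lemma IsOptimal.of_swap {a : ℝ} {m : Fin 5 → ℝ → ℝ → Prop}
    (h : IsOptimal a fun i x y => m i y x) : IsOptimal a m := by
  have hu : ‖pt 0 1‖ = 1 := by simp [norm_plane_eq_one]
  have hv : ‖pt 1 0‖ = 1 := by simp [norm_plane_eq_one]
  have huv : inner ℝ (pt 0 1) (pt 1 0) = 0 := by simp [inner_plane]
  refine IsOptimal.of_isometry (frameIso (pt 0 0) (pt 0 1) (pt 1 0) hu hv huv) (fun z => ?_) ?_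
  · simp [mem_box, frameIso_apply]
    tauto
  · simpa [frameIso_apply] using h

lemma IsOptimal.of_flip {a : ℝ} {m : Fin 5 → ℝ → ℝ → Prop}
    (h : IsOptimal a fun i x y => m i (a - x) y) : IsOptimal a m := by
  have hu : ‖pt (-1) 0‖ = 1 := by simp [norm_plane_eq_one]
  have hv : ‖pt 0 1‖ = 1 := by simp [norm_plane_eq_one]
  have huv : inner ℝ (pt (-1) 0) (pt 0 1) = 0 := by simp [inner_plane]
  refine IsOptimal.of_isometry (frameIso (pt a 0) (pt (-1) 0) (pt 0 1) hu hv huv) (fun z => ?_) ?_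
  · simp [mem_box, frameIso_apply]
    tauto
  · simpa [frameIso_apply, sub_eq_add_neg] using h

lemma IsOptimal.of_flip' {a : ℝ} {m : Fin 5 → ℝ → ℝ → Prop}
    (h : IsOptimal a fun i x y => m i x (a - y)) : IsOptimal a m :=
  .of_swap (.of_flip (m := fun i x y => m i y x) (.of_swap h))

/-- How the reflection in the line `y = x` permutes the vertices. -/
def swapPerm : Equiv.Perm (Fin 5) :=
  ⟨![0, 2, 1, 3, 4], ![0, 2, 1, 3, 4], by decide, by decide⟩

@[simp] lemma swapPerm_apply : swapPerm 0 = 0 ∧ swapPerm 1 = 2 ∧ swapPerm 2 = 1 ∧ swapPerm 3 = 3 ∧ swapPerm 4 = 4 :=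
  ⟨rfl, rfl, rfl, rfl, rfl⟩

/-- How the reflection in a vertical line permutes the vertices. -/
def flipPerm : Equiv.Perm (Fin 5) :=
  ⟨![1, 0, 3, 2, 4], ![1, 0, 3, 2, 4], by decide, by decide⟩

@[simp] lemma flipPerm_apply : flipPerm 0 = 1 ∧ flipPerm 1 = 0 ∧ flipPerm 2 = 3 ∧ flipPerm 3 = 2 ∧ flipPerm 4 = 4 :=
  ⟨rfl, rfl, rfl, rfl, rfl⟩

/-- How the reflection in a horizontal line permutes the vertices. -/
def flipPerm' : Equiv.Perm (Fin 5) :=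
  ⟨![2, 3, 0, 1, 4], ![2, 3, 0, 1, 4], by decide, by decide⟩

@[simp] lemma flipPerm'_apply : flipPerm' 0 = 2 ∧ flipPerm' 1 = 3 ∧ flipPerm' 2 = 0 ∧ flipPerm' 3 = 1 ∧ flipPerm' 4 = 4 :=
  ⟨rfl, rfl, rfl, rfl, rfl⟩

/-! ### Five unit squares: rigidity and reduction by symmetry. -/

/-- The contact points give leg inequalities to which `legs_eq` applies. The resulting values make
every leg or diagonal extremal, and an extremal square is unique, so it agrees with its counterpart
in the model. -/
lemma isOptimal_of_points_of_le {a p q t y y' : ℝ} {m : Fin 5 → ℝ → ℝ → Prop}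
    (ha : xbar + 1 ≤ a) (hm : ∀ i, IsUnitSq (m i)) (h0 : m 0 0 0) (h1 : m 1 a 0) (h2 : m 2 0 a)
    (h3 : m 3 a a) (p0 : 0 ≤ p) (t0 : 0 ≤ t) (y0 : 0 ≤ y) (ya : y' ≤ a)
    (hp : m 0 p 0) (hp' : m 1 p 0) (hq : m 0 0 q) (hq' : m 2 0 q) (ht : m 2 t a) (ht' : m 3 t a)
    (hy : m 1 a y) (hy' : m 3 a y') (hyy : m 4 a y ∧ m 4 a y' ∨ y = y') (hqa : q ≤ a - q) :
    IsOptimal a m := by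
  obtain ⟨b1, b2⟩ := xbar_bounds
  obtain ⟨r1, r2⟩ := sqrt_two_bounds
  have key := legs_eq (p := p) (t := t) (y := y) (y' := y') ha hqa
    (fun h => (hm 0).swap.leg_bound h p0 h0 hq hp)
    (fun h => ((hm 1).flip a).leg_bound h y0 (by simpa) (by simpa) (by simpa))
    (fun h => ((hm 2).flip' a).swap.leg_bound h t0 (by simpa) (by simpa) (by simpa))
    (fun h => (((hm 3).flip' a).flip a).leg_bound h (by linarith) (by simpa) (by simpa) (by simpa))
    ((hm 1).sub_le_sqrt_two hp' h1) ((hm 3).sub_le_sqrt_two ht' h3)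
    ((hm 2).sub_le_sqrt_two' hq' h2)
    (hyy.elim (fun h => (hm 4).sub_le_sqrt_two' h.1 h.2) fun h => by
      rw [h, sub_self]; exact Real.sqrt_nonneg 2) ya
  obtain ⟨rfl, rfl, rfl, rfl, rfl, rfl⟩ := key
  obtain ⟨h4, h4'⟩ : m 4 (xbar + 1) (xbar + 1 - √2) ∧ m 4 (xbar + 1) (xbar + 1) := by
    rcases hyy with h | h
    exacts [h, by linarith]
  obtain ⟨z1, z2, z3⟩ := mem_opt_zero
  obtain ⟨o1, o2, o3⟩ := mem_opt_one
  obtain ⟨w1, w2, w3⟩ := mem_opt_two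
  obtain ⟨v1, v2⟩ := mem_opt_three
  obtain ⟨f1, f2⟩ := mem_opt_four
  have e0 : ∀ x y, m 0 x y ↔ pt x y ∈ optUnitSquare 0 := (hm 0).iff_of_legs (isUnitSq_opt 0)
    (x := 1) (y := 1) (w := 0) le_rfl zero_le_one le_rfl (by norm_num) (by norm_num) h0 hp hq z1 z2 z3
  have e1 : ∀ x y, m 1 x y ↔ pt x y ∈ optUnitSquare 1 := fun x y => by
    have := ((hm 1).flip (xbar + 1)).iff_of_legs ((isUnitSq_opt 1).flip (xbar + 1))
      (x := xbar) (y := xbar + 1 - √2) (w := wbar) (by linarith) (by linarith) wbar_nonneg wbar_sq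
      leg_xbar (by simpa) (by simpa) (by simpa) (by simpa) (by simpa) (by simpa) (xbar + 1 - x) y
    simpa only [sub_sub_cancel] using this
  have e2 : ∀ x y, m 2 x y ↔ pt x y ∈ optUnitSquare 2 := fun x y => by
    have := ((hm 2).flip' (xbar + 1)).swap.iff_of_legs ((isUnitSq_opt 2).flip' (xbar + 1)).swap
      (x := xbar) (y := xbar + 1 - √2) (w := wbar) (by linarith) (by linarith) wbar_nonneg wbar_sq
      leg_xbar (by simpa) (by simpa) (by simpa) (by simpa) (by simpa) (by simpa) (xbar + 1 - y) x
    simpa only [sub_sub_cancel] using this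
  have e3 : ∀ x y, m 3 x y ↔ pt x y ∈ optUnitSquare 4 := fun x y => by
    have := (((hm 3).flip' (xbar + 1)).flip (xbar + 1)).iff_of_diagonal
      (((isUnitSq_opt 4).flip' (xbar + 1)).flip (xbar + 1)) (by simpa) (by simpa) (by simpa)
      (by simpa) (xbar + 1 - x) (xbar + 1 - y)
    simpa only [sub_sub_cancel] using this
  have e4 : ∀ x y, m 4 x y ↔ pt x y ∈ optUnitSquare 3 := fun x y => by
    have := (((hm 4).flip' (xbar + 1)).flip (xbar + 1)).swap.iff_of_diagonal
      (((isUnitSq_opt 3).flip' (xbar + 1)).flip (xbar + 1)).swap (by simpa) (by simpa) (by simpa)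
      (by simpa) (xbar + 1 - y) (xbar + 1 - x)
    simpa only [sub_sub_cancel] using this
  have es : ∀ i j, (∀ x y, m i x y ↔ pt x y ∈ optUnitSquare j) →
      {z : Plane | m i (z 0) (z 1)} = IsometryEquiv.refl Plane '' optUnitSquare j := by
    intro i j h
    refine Eq.trans ?_ (image_id _).symm
    ext z
    simp [h]
  -- The square assigned to the vertex `(a, a)` has its diagonal on the top side, and the fifth one
  -- has its diagonal on the right side; the model lists them in the other order.
  refine ⟨rfl, IsometryEquiv.refl _, Equiv.swap 3 4, (image_id _).symm, fun i => ?_⟩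
  fin_cases i
  exacts [es 0 0 e0, es 1 1 e1, es 2 2 e2, es 3 4 e3, es 4 3 e4]

/-- Reflection in the horizontal midline exchanges `q` and `a - q`, so the contact point on the left
may be taken in the lower half. -/
lemma isOptimal_of_points {a p q t y y' : ℝ} {m : Fin 5 → ℝ → ℝ → Prop}
    (ha : xbar + 1 ≤ a) (hm : ∀ i, IsUnitSq (m i)) (h0 : m 0 0 0) (h1 : m 1 a 0) (h2 : m 2 0 a)
    (h3 : m 3 a a) (p0 : 0 ≤ p) (t0 : 0 ≤ t) (y0 : 0 ≤ y) (ya : y' ≤ a)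
    (hp : m 0 p 0) (hp' : m 1 p 0) (hq : m 0 0 q) (hq' : m 2 0 q) (ht : m 2 t a) (ht' : m 3 t a)
    (hy : m 1 a y) (hy' : m 3 a y') (hyy : m 4 a y ∧ m 4 a y' ∨ y = y') : IsOptimal a m := by
  rcases le_total q (a - q) with hqa | hqa
  · exact isOptimal_of_points_of_le ha hm h0 h1 h2 h3 p0 t0 y0 ya hp hp' hq hq' ht ht' hy hy' hyy
      hqa
  refine .of_flip' (.of_perm flipPerm' ?_)
  refine isOptimal_of_points_of_le (p := t) (q := a - q) (t := p) (y := a - y') (y' := a - y) ha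
    (fun i => (hm _).flip' a) (by simpa using h2) (by simpa using h3) (by simpa using h0)
    (by simpa using h1) t0 p0 (by linarith) (by linarith) ?_ ?_ ?_ ?_ ?_ ?_ ?_ ?_ ?_ (by linarith)
  · simpa using ht
  · simpa using ht'
  · simpa using hq'
  · simpa using hq
  · simpa using hp
  · simpa using hp'
  · simpa using hy'
  · simpa using hy
  · simp only [flipPerm'_apply, sub_sub_cancel]
    exact hyy.imp And.symm fun h => by rw [h]

/-- Five unit squares cover the boundary of `[0, a]²` and the first four of them contain the
vertices. -/
structure CornerCover (a : ℝ) (m : Fin 5 → ℝ → ℝ → Prop) : Prop where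
  isUnitSq : ∀ i, IsUnitSq (m i)
  coversBd : CoversBd m a
  mem_zero : m 0 0 0
  mem_one : m 1 a 0
  mem_two : m 2 0 a
  mem_three : m 3 a a

namespace CornerCover

variable {a : ℝ} {m : Fin 5 → ℝ → ℝ → Prop}

lemma swap (h : CornerCover a m) :
    CornerCover a fun i x y => m (swapPerm i) y x where
  isUnitSq i := (h.isUnitSq _).swap
  coversBd x y hxy := by
    obtain ⟨i, hi⟩ := h.coversBd y x hxy.symm
    exact ⟨swapPerm.symm i, by simpa⟩
  mem_zero := by simpa using h.mem_zero
  mem_one := by simpa using h.mem_two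
  mem_two := by simpa using h.mem_one
  mem_three := by simpa using h.mem_three

lemma flip (h : CornerCover a m) :
    CornerCover a fun i x y => m (flipPerm i) (a - x) y where
  isUnitSq i := (h.isUnitSq _).flip a
  coversBd x y hxy := by
    obtain ⟨i, hi⟩ := h.coversBd (a - x) y (by
      rcases hxy with ⟨⟨h1, h2⟩, h3⟩ | ⟨h1, h2 | h2⟩
      · exact .inl ⟨⟨by linarith, by linarith⟩, h3⟩
      · exact .inr ⟨h1, .inr (by linarith)⟩
      · exact .inr ⟨h1, .inl (by linarith)⟩)
    exact ⟨flipPerm.symm i, by simpa using hi⟩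
  mem_zero := by simpa using h.mem_one
  mem_one := by simpa using h.mem_zero
  mem_two := by simpa using h.mem_three
  mem_three := by simpa using h.mem_two

lemma not_opposite (h : CornerCover a m) (ha : √2 < a) (i : Fin 5) {x x' : ℝ} (h1 : m i x 0)
    (h2 : m i x' a) : False :=
  (h.isUnitSq i).not_opposite ha h1 h2

lemma not_opposite' (h : CornerCover a m) (ha : √2 < a) (i : Fin 5) {y y' : ℝ} (h1 : m i 0 y)
    (h2 : m i a y') : False :=
  (h.isUnitSq i).not_opposite' ha h1 h2

lemma exists_bottom (h : CornerCover a m) (ha : √2 < a) (hE : ∀ x, ¬ m 4 x 0) :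
    ∃ p, (0 ≤ p ∧ p ≤ a) ∧ m 0 p 0 ∧ m 1 p 0 :=
  exists_mem_both ((h.isUnitSq 0).isClosed 0) ((h.isUnitSq 1).isClosed 0)
    ((Real.sqrt_nonneg 2).trans ha.le) h.mem_zero h.mem_one fun x hx0 hx1 => by
      obtain ⟨i, hi⟩ := h.coversBd.sides.1 x hx0 hx1
      fin_cases i
      exacts [.inl hi, .inr hi, (h.not_opposite ha 2 hi h.mem_two).elim,
        (h.not_opposite ha 3 hi h.mem_three).elim, (hE x hi).elim]

lemma exists_left (h : CornerCover a m) (ha : √2 < a) (hE : ∀ y, ¬ m 4 0 y) :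
    ∃ q, (0 ≤ q ∧ q ≤ a) ∧ m 0 0 q ∧ m 2 0 q := by
  simpa using h.swap.exists_bottom ha (by simpa using hE)

/-- The case in which the fifth square meets the right side and no other one, except perhaps at the
vertex `(a, a)`. -/
lemma isOptimal_of_right (h : CornerCover a m) (ha : xbar + 1 ≤ a) (hb : ∀ x, ¬ m 4 x 0)
    (hl : ∀ y, ¬ m 4 0 y) (ht : ∀ x, m 4 x a → x = a) : IsOptimal a m := by
  have ha2 : √2 < a := by linarith [xbar_bounds.1, sqrt_two_bounds.2]
  have ha0 : 0 ≤ a := (Real.sqrt_nonneg 2).trans ha2.le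
  obtain ⟨p, ⟨p0, -⟩, hp, hp'⟩ := h.exists_bottom ha2 hb
  obtain ⟨q, -, hq, hq'⟩ := h.exists_left ha2 hl
  obtain ⟨t, ⟨t0, -⟩, ht, ht'⟩ := exists_mem_both ((h.isUnitSq 2).isClosed a)
    ((h.isUnitSq 3).isClosed a) ha0 h.mem_two h.mem_three fun x hx0 hx1 => by
      obtain ⟨i, hi⟩ := h.coversBd.sides.2.2.1 x hx0 hx1
      fin_cases i
      exacts [(h.not_opposite ha2 0 h.mem_zero hi).elim, (h.not_opposite ha2 1 h.mem_one hi).elim,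
        .inl hi, .inr hi, .inr (ht x hi ▸ h.mem_three)]
  have cl : ∀ i, IsClosed {y | m i a y} := fun i => (h.isUnitSq i).swap.isClosed a
  have hright : ∀ y, 0 ≤ y → y ≤ a → m 1 a y ∨ m 3 a y ∨ m 4 a y := fun y hy0 hy1 => by
    obtain ⟨i, hi⟩ := h.coversBd.sides.2.2.2 y hy0 hy1
    fin_cases i
    exacts [(h.not_opposite' ha2 0 h.mem_zero hi).elim, .inl hi,
      (h.not_opposite' ha2 2 h.mem_two hi).elim, .inr (.inl hi), .inr (.inr hi)]
  -- Squares 1 and 3 either touch directly on the right side or are linked by the fifth square;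
  -- grouping the fifth with each of them in turn produces the link.
  obtain ⟨y₁, ⟨y10, y11⟩, hy₁, hy₁'⟩ := exists_mem_both (f := fun y => m 1 a y)
    (g := fun y => m 3 a y ∨ m 4 a y) (cl 1) ((cl 3).union (cl 4)) ha0 h.mem_one
    (.inl h.mem_three) hright
  obtain ⟨y₂, ⟨y20, y21⟩, hy₂, hy₂'⟩ := exists_mem_both (f := fun y => m 1 a y ∨ m 4 a y)
    (g := fun y => m 3 a y) ((cl 1).union (cl 4)) (cl 3) ha0 (.inl h.mem_one)
    h.mem_three fun y hy0 hy1 => by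
      have := hright y hy0 hy1
      tauto
  have main : ∃ y y', 0 ≤ y ∧ y' ≤ a ∧ m 1 a y ∧ m 3 a y' ∧ (m 4 a y ∧ m 4 a y' ∨ y = y') := by
    rcases hy₁' with h5 | h5
    · exact ⟨y₁, y₁, y10, y11, hy₁, h5, .inr rfl⟩
    rcases hy₂ with h6 | h6
    · exact ⟨y₂, y₂, y20, y21, h6, hy₂', .inr rfl⟩
    · exact ⟨y₁, y₂, y10, y21, hy₁, hy₂', .inl ⟨h5, h6⟩⟩
  obtain ⟨y, y', y0, y1, hy, hy', hyy⟩ := main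
  exact isOptimal_of_points ha h.isUnitSq h.mem_zero h.mem_one h.mem_two h.mem_three p0 t0 y0 y1
    hp hp' hq hq' ht ht' hy hy' hyy

/-- Since `a - p ≥ x̄`, square 1 reaches at most to height `x̄ + 1 - √2` on the right side. So `(a,
a - √2)` lies in square 3 or in the fifth, and whichever contains it can meet the top side only at
`(a, a)`. -/
lemma isOptimal_of_le_one (h : CornerCover a m) (ha : xbar + 1 ≤ a) (hb : ∀ x, ¬ m 4 x 0)
    (hl : ∀ y, ¬ m 4 0 y) {p : ℝ} (hp1 : p ≤ 1) (hp : m 1 p 0) : IsOptimal a m := by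
  obtain ⟨b1, b2⟩ := xbar_bounds
  obtain ⟨r1, r2⟩ := sqrt_two_bounds
  have ha2 : √2 < a := by linarith
  have hs : (√2) ^ 2 = 2 := Real.sq_sqrt (by norm_num)
  have hB : ∀ y, 0 ≤ y → m 1 a y → y ≤ xbar + 1 - √2 := fun y y0 hy => by
    have h1 := ((h.isUnitSq 1).flip a).leg_bound (x := a - p) (by linarith) y0
      (by simpa using h.mem_one) (by simpa) (by simpa)
    have h2 := leg_le_above_xbar (x := a - p) (by linarith)
      ((h.isUnitSq 1).sub_le_sqrt_two hp h.mem_one)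
    linarith
  have cl : ∀ i, IsClosed {y | m i a y} := fun i => (h.isUnitSq i).swap.isClosed a
  have hcov : Icc (xbar + 1 - √2) a ⊆ {y | m 3 a y} ∪ {y | m 4 a y} := by
    -- Square 1 may contain the lower end point, so the cover by the other two is first shown above
    -- it and then passes to the closure.
    rw [← closure_Ioc (by linarith : xbar + 1 - √2 ≠ a),
      ((cl 3).union (cl 4)).closure_subset_iff]
    rintro y ⟨hy0, hy1⟩
    obtain ⟨i, hi⟩ := h.coversBd.sides.2.2.2 y (by linarith) hy1
    fin_cases i
    exacts [(h.not_opposite' ha2 0 h.mem_zero hi).elim,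
      (not_lt.2 (hB y (by linarith) hi) hy0).elim,
      (h.not_opposite' ha2 2 h.mem_two hi).elim, .inl hi, .inr hi]
  have top_eq : ∀ i x, m i a (a - √2) → m i x a → x = a := fun i x h1 h2 => by
    have h3 := (h.isUnitSq i).sq_add_sq_le h1 h2
    have h4 : (a - x) ^ 2 = 0 := le_antisymm (by nlinarith) (sq_nonneg _)
    linarith [pow_eq_zero_iff two_ne_zero |>.1 h4]
  rcases hcov (show a - √2 ∈ Icc _ _ from ⟨by linarith, by linarith⟩) with h3 | h4
  -- Here square 3 leaves the top side, apart from its end, to square 2 and the fifth. By closedness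
  -- the fifth then contains `(a, a)`, and it exchanges roles with square 3.
  · have hmem : m 4 a a := by
      have hsub : Icc 0 a ⊆ {x | m 2 x a} ∪ {x | m 4 x a} := by
        rw [← closure_Ico (by linarith : (0 : ℝ) ≠ a), (((h.isUnitSq 2).isClosed a).union
          ((h.isUnitSq 4).isClosed a)).closure_subset_iff]
        rintro x ⟨hx0, hx1⟩
        obtain ⟨i, hi⟩ := h.coversBd.sides.2.2.1 x hx0 hx1.le
        fin_cases i
        exacts [(h.not_opposite ha2 0 h.mem_zero hi).elim,
          (h.not_opposite ha2 1 h.mem_one hi).elim, .inl hi, (hx1.ne (top_eq 3 x h3 hi)).elim,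
          .inr hi]
      rcases hsub (show a ∈ Icc 0 a from ⟨by linarith, le_rfl⟩) with h5 | h5
      exacts [(h.not_opposite' ha2 2 h.mem_two h5).elim, h5]
    refine .of_perm (Equiv.swap 3 4) ?_
    have hC : CornerCover a fun i => m (Equiv.swap 3 4 i) :=
      ⟨fun i => h.isUnitSq _, fun x y hxy => by
        obtain ⟨i, hi⟩ := h.coversBd x y hxy
        exact ⟨Equiv.swap 3 4 i, by simpa⟩, h.mem_zero, h.mem_one, h.mem_two, by simpa using hmem⟩
    refine hC.isOptimal_of_right ha ?_ ?_ ?_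
    · simpa using fun x hx => h.not_opposite ha2 3 hx h.mem_three
    · simpa using fun y hy => h.not_opposite' ha2 3 hy h.mem_three
    · simpa using fun x hx => top_eq 3 x h3 hx
  · exact h.isOptimal_of_right ha hb hl fun x hx => top_eq 4 x h4 hx

/-- The legs of square 0 satisfy `p² + q² ≤ 2`, so one of them is at most 1; the diagonal reflection
makes it `p`. -/
lemma isOptimal_of_not_left_bottom (h : CornerCover a m) (ha : xbar + 1 ≤ a)
    (hb : ∀ x, ¬ m 4 x 0) (hl : ∀ y, ¬ m 4 0 y) : IsOptimal a m := by
  have ha2 : √2 < a := by linarith [xbar_bounds.1, sqrt_two_bounds.2]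
  obtain ⟨p, -, hp, hp'⟩ := h.exists_bottom ha2 hb
  obtain ⟨q, -, hq, hq'⟩ := h.exists_left ha2 hl
  rcases le_or_gt p 1 with hp1 | hp1
  · exact h.isOptimal_of_le_one ha hb hl hp1 hp'
  · have hq1 : q ≤ 1 := by
      have := (h.isUnitSq 0).sq_add_sq_le hp hq
      nlinarith
    exact .of_swap (.of_perm swapPerm (h.swap.isOptimal_of_le_one ha (by simpa using hl)
      (by simpa using hb) hq1 (by simpa using hq')))

/-- If the fifth square meets the bottom side, it misses the top side, and a symmetry carries the
left and top sides to the bottom and left ones. -/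
lemma isOptimal_of_not_left (h : CornerCover a m) (ha : xbar + 1 ≤ a)
    (hl : ∀ y, ¬ m 4 0 y) : IsOptimal a m := by
  have ha2 : √2 < a := by linarith [xbar_bounds.1, sqrt_two_bounds.2]
  by_cases hb : ∃ x, m 4 x 0
  · obtain ⟨x, hx⟩ := hb
    refine .of_swap (.of_perm swapPerm (.of_flip
      (.of_perm flipPerm ?_)))
    refine h.swap.flip.isOptimal_of_not_left_bottom ha ?_ ?_
    · simp only [flipPerm_apply, swapPerm_apply]
      exact fun x => hl _
    · simp only [flipPerm_apply, swapPerm_apply, sub_zero]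
      exact fun y hy => h.not_opposite ha2 4 hx hy
  · push Not at hb
    exact h.isOptimal_of_not_left_bottom ha hb hl

lemma isOptimal (h : CornerCover a m) (ha : xbar + 1 ≤ a) : IsOptimal a m := by
  have ha2 : √2 < a := by linarith [xbar_bounds.1, sqrt_two_bounds.2]
  by_cases hl : ∃ y, m 4 0 y
  · obtain ⟨y, hy⟩ := hl
    refine .of_flip (.of_perm flipPerm ?_)
    refine h.flip.isOptimal_of_not_left ha ?_
    simp only [flipPerm_apply, sub_zero]
    exact fun y' hy' => h.not_opposite' ha2 4 hy hy'
  · push Not at hl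
    exact h.isOptimal_of_not_left ha hl

end CornerCover

/-- Five unit squares that cover the boundary of `[0, a]²` with `a ≥ x̄ + 1` form an optimal
configuration. -/
theorem CoversBd.isOptimal {a : ℝ} {m : Fin 5 → ℝ → ℝ → Prop} (h : CoversBd m a)
    (hm : ∀ i, IsUnitSq (m i)) (ha : xbar + 1 ≤ a) : IsOptimal a m := by
  have ha2 : √2 < a := by linarith [xbar_bounds.1, sqrt_two_bounds.2]
  obtain ⟨f, hf, h0, h1, h2, h3⟩ := h.exists_corners hm ha2
  obtain ⟨j, hj⟩ : ∃ j, j ∉ Set.range f := by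
    by_contra hc
    push Not at hc
    have := Fintype.card_le_of_surjective f hc
    simp at this
  have hinj : Function.Injective (Fin.snoc f j : Fin 5 → Fin 5) :=
    Fin.snoc_injective_iff.2 ⟨hf, hj⟩
  set σ : Equiv.Perm (Fin 5) := Equiv.ofBijective _ (Finite.injective_iff_bijective.1 hinj)
  refine .of_perm σ (CornerCover.isOptimal ⟨fun i => hm _, fun x y hxy => ?_, h0, h1, h2, h3⟩ ha)
  obtain ⟨i, hi⟩ := h x y hxy
  exact ⟨σ.symm i, by simpa⟩

lemma Sbd_five : Sbd 5 = xbar + 1 := by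
  obtain ⟨-, m, hm, h⟩ := mem_bdCoverableEdges.1 (isGreatest_Sbd (n := 5) (by norm_num)).1
  exact (h.isOptimal hm xbar_add_one_le_Sbd).1

theorem isOptimalConfiguration_of_cover {Q : Set Plane} {F : Fin 5 → Set Plane}
    (hQ : IsSquareOfEdge (Sbd 5) Q) (hF : IsUnitSquareCover F (frontier Q)) :
    IsOptimalConfiguration Q F := by
  obtain ⟨φ, rfl⟩ := hQ.exists_image_box
  obtain ⟨hm, h⟩ := coversBd_of_cover hQ.1 rfl hF
  have := (h.isOptimal hm xbar_add_one_le_Sbd).2.image φ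
  have e : ∀ i, φ '' {z | φ (pt (z 0) (z 1)) ∈ F i} = F i := by
    intro i
    ext z
    obtain ⟨w, rfl⟩ := φ.surjective z
    rw [φ.injective.mem_set_image]
    simp
  simpa only [e] using this

/-! ### The whole square cannot be covered at the optimal size. -/

/-- The value 1.1 is slightly more than `x̄`. In the frames of squares 1 and 2 the point's first
coordinate is `(1.1 + 0.1 w) / x̄ > 1`, where `w` is `wbar`; the two squares with diagonals on the
sides do not reach so far inward. -/
lemma not_mem_optUnitSquare (i : Fin 5) : pt 1.1 1.1 ∉ optUnitSquare i := by
  obtain ⟨b1, b2⟩ := xbar_bounds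
  obtain ⟨r1, r2⟩ := sqrt_two_bounds
  have hs : (√2) ^ 2 = 2 := Real.sq_sqrt (by norm_num)
  have hx := xbar_pos
  have hw := wbar_sq
  have hw0 := wbar_nonneg
  rintro hi
  fin_cases i <;> obtain ⟨s, ⟨hs0, hs1⟩, t, ⟨ht0, ht1⟩, e⟩ := hi <;>
    (have e0 := congrArg (fun z : Plane => z 0) e
     have e1 := congrArg (fun z : Plane => z 1) e
     simp at e0 e1)
  · linarith
  · have e2 : 0.1 * xbar = s * wbar + t := by field_simp at e0; linarith
    have e3 : 1.1 * xbar = s - t * wbar := by field_simp at e1; linarith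
    have e4 : xbar * (s * xbar) = xbar * (0.1 * wbar + 1.1) := by
      linear_combination (-s) * hw - wbar * e2 - e3
    have e5 := mul_left_cancel₀ hx.ne' e4
    nlinarith
  · have e2 : 0.1 * xbar = s * wbar + t := by field_simp at e1; linarith
    have e3 : 1.1 * xbar = s - t * wbar := by field_simp at e0; linarith
    have e4 : xbar * (s * xbar) = xbar * (0.1 * wbar + 1.1) := by
      linear_combination (-s) * hw - wbar * e2 - e3
    have e5 := mul_left_cancel₀ hx.ne' e4
    nlinarith
  · have : 0 ≤ (1 - (t - s)) * √2 := mul_nonneg (by linarith) (by linarith)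
    linarith
  · have : 0 ≤ (1 - (t - s)) * √2 := mul_nonneg (by linarith) (by linarith)
    linarith

/-- A cover of a square of edge at least `Sbd 5` also covers its boundary, so it would be the
optimal configuration, which leaves an interior point uncovered. -/
lemma S_five_lt : S 5 < Sbd 5 := by
  obtain ⟨hS, m, hm, h⟩ := mem_coverableEdges.1 (isGreatest_S (n := 5) (by norm_num)).1
  have hbd : CoversBd m (S 5) := fun x y hxy => h x y (by
    rcases hxy with ⟨⟨h1, h2⟩, h | h⟩ | ⟨⟨h1, h2⟩, h | h⟩ <;> subst h <;>
      refine ⟨⟨?_, ?_⟩, ?_, ?_⟩ <;> linarith)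
  by_contra hlt
  rw [Sbd_five, not_lt] at hlt
  obtain ⟨-, φ, σ, hQ, hF⟩ := hbd.isOptimal hm hlt
  have hz : φ (pt 1.1 1.1) ∈ box (S 5) := by
    rw [hQ]
    refine ⟨_, mem_box.2 ?_, rfl⟩
    simp only [pt_zero, pt_one]
    refine ⟨⟨?_, ?_⟩, ?_, ?_⟩ <;> linarith [xbar_bounds.1]
  obtain ⟨i, hi⟩ := h _ _ (mem_box.1 hz)
  have hmem : φ (pt 1.1 1.1) ∈ {z : Plane | m i (z 0) (z 1)} := hi
  rw [show {z : Plane | m i (z 0) (z 1)} = φ '' optUnitSquare (σ i) from hF i,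
    φ.injective.mem_set_image] at hmem
  exact not_mem_optUnitSquare _ hmem

end SquareCover

end

theorem theorem3 :
    -- the maximum defining `Sbd n` exists, and (i)
    (∀ n : ℕ, 4 ≤ n → IsGreatest (SquareCover.bdCoverableEdges n) (SquareCover.Sbd n) ∧
      SquareCover.Sbd (n + 4) = SquareCover.Sbd n + √2) ∧
    -- (ii)
    (SquareCover.Sbd 4 = 2 ∧
      ∀ (Q : Set SquareCover.Plane) (F : Fin 4 → Set SquareCover.Plane),
        SquareCover.IsSquareOfEdge 2 Q → SquareCover.IsUnitSquareCover F (frontier Q) →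
        ∀ i, SquareCover.IsHomotheticTo (F i) Q) ∧
    -- (iii)
    (SquareCover.Sbd 5 = 1 / 2 * √2 * √(√(13 - 8 * √2) + 1) + 1 ∧
      |SquareCover.Sbd 5 - 2.072| < 0.0005 ∧
      (∀ (Q : Set SquareCover.Plane) (F : Fin 5 → Set SquareCover.Plane),
        SquareCover.IsSquareOfEdge (SquareCover.Sbd 5) Q →
        SquareCover.IsUnitSquareCover F (frontier Q) →
        SquareCover.IsOptimalConfiguration Q F) ∧
      IsGreatest (SquareCover.coverableEdges 5) (SquareCover.S 5) ∧
      SquareCover.S 5 < SquareCover.Sbd 5) := by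
  have e : SquareCover.Sbd 5 = 1 / 2 * √2 * √(√(13 - 8 * √2) + 1) + 1 := SquareCover.Sbd_five
  refine ⟨fun n hn => ⟨SquareCover.isGreatest_Sbd (by omega),
      le_antisymm (SquareCover.Sbd_le_add_sqrt_two hn) (SquareCover.Sbd_add_sqrt_two_le hn)⟩,
    ⟨SquareCover.Sbd_four, fun Q F hQ hF => SquareCover.isHomotheticTo_of_cover hQ hF⟩, e, ?_,
    fun Q F hQ hF => SquareCover.isOptimalConfiguration_of_cover hQ hF,
    SquareCover.isGreatest_S (by norm_num), SquareCover.S_five_lt⟩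
  obtain ⟨h1, h2⟩ := SquareCover.xbar_bounds
  rw [SquareCover.Sbd_five, abs_lt]
  constructor <;> linarith
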